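/- A \emph{pointed dcpo} is a partially ordered set with a least element $\bot$ in which every nonempty directed subset has a supremum; $\mathbf{Dcpo}_{\perp!}$ is the category of pointed dcpos and strict (i.e. $\bot$-preserving) Scott-continuous maps, with hom-sets ordered pointwise. A category whose hom-sets are partially ordered is \emph{$\mathbf{Dcpo}_{\perp!}$-enriched} if its hom-sets are pointed dcpos and composition is strict and Scott-continuous in each argument. A functor $F$ between categories with ordered hom-sets is \emph{locally continuous} if every map $f\mapsto F(f)$, $\mathcal C(X,Y)\to\mathcal D(FX,FY)$, is Scott-continuous, and \emph{locally strict} if it preserves least morphisms. A \emph{Kegelspitze} is a pointed dcpo $X$ with a convex structure (operations $(x_1,\dots,x_n)\mapsto\sum_i r_i x_i$ for all $r_i\ge 0$ with $\sum_i r_i=1$, satisfying the usual unit and associativity laws) such that all these operations $X^n\to X$ are Scott-continuous and the scalar multiplication $[0,1]\times X\to X$, $(\lambda,x)\mapsto \lambda x+(1-\lambda)\bot$, is Scott-continuous. $\mathbf{KS}$ is the category of Kegelspitzen and affine strict Scott-continuous maps, with hom-sets ordered pointwise. Let $\mathbb L_{\le 1}$ be the category whose objects are the natural numbers and whose morphisms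 $n\to m$ are families of $m$ subprobability distributions on an $n$-element set, i.e. $m\times n$ matrices of non-negative reals with $\sum_{j\le n}a_{ij}\le 1$ for every $i\le m$; composition is matrix multiplication and morphisms are ordered entrywise. Let $[\mathbb L_{\le 1},\mathbf{Dcpo}_{\perp!}]_\times$ be the category of finite-product-preserving, locally strict and locally continuous functors $\mathbb L_{\le 1}\to\mathbf{Dcpo}_{\perp!}$ and natural transformations, ordered pointwise. A category $\mathcal C$ is \emph{algebraically compact} for a class of endofunctors if every $F:\mathcal C\to\mathcal C$ in the class has a fixpoint $e:FA\cong A$ such that $(A,e)$ is an initial $F$-algebra and $(A,e^{-1})$ is a final $F$-coalgebra. \textbf{Corollary.} The categories $\mathbf{KS}$ and $[\mathbb L_{\le 1},\mathbf{Dcpo}_{\perp!}]_\times$ are $\mathbf{Dcpo}_{\perp!}$-enriched, and there is an equivalence of categories $\Phi:\mathbf{KS}\simeq[\mathbb L_{\le 1},\mathbf{Dcpo}_{\perp!}]_\times$ with $f\le g\iff\Phi(f)\le\Phi(g)$ for all parallel morphisms $f,g$ of $\mathbf{KS}$. Both $\mathbf{KS}$ and $[\mathbb L_{\le 1},\mathbf{Dcpo}_{\perp!}]_\times$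 are algebraically compact for the class of locally continuous endofunctors. -/

import Mathlib

open CategoryTheory CategoryTheory.Limits
open scoped NNReal

universe v v' u u'

noncomputable section

/-! ## Order-enriched categories and algebraic compactness -/

/-- A category whose hom-sets carry given partial orders is enriched in pointed dcpos and strict
Scott-continuous maps: every hom-set has suprema of all directed subsets (the empty one included,
so that there is a least morphism), and composition is Scott-continuous and strict in each
argument. -/
structure IsDcpoBotEnriched (C : Type u) [Category.{v} C]
    [∀ X Y : C, PartialOrder (X ⟶ Y)] : Prop where
  exists_isLUB : ∀ (X Y : C) (d : Set (X ⟶ Y)), DirectedOn (· ≤ ·) d → ∃ f, IsLUB d f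
  precomp_scottContinuous : ∀ (X Y Z : C) (f : X ⟶ Y), ScottContinuous (fun g : Y ⟶ Z => f ≫ g)
  postcomp_scottContinuous : ∀ (X Y Z : C) (g : Y ⟶ Z), ScottContinuous (fun f : X ⟶ Y => f ≫ g)
  precomp_strict : ∀ (X Y Z : C) (f : X ⟶ Y) (b : Y ⟶ Z), IsBot b → IsBot (f ≫ b)
  postcomp_strict : ∀ (X Y Z : C) (b : X ⟶ Y) (g : Y ⟶ Z), IsBot b → IsBot (b ≫ g)

/-- A functor is locally continuous if its action on each hom-set is Scott-continuous. -/
def IsLocallyContinuous {C : Type u} [Category.{v} C] [∀ X Y : C, PartialOrder (X ⟶ Y)]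
    {D : Type u'} [Category.{v'} D] [∀ X Y : D, PartialOrder (X ⟶ Y)] (F : C ⥤ D) : Prop :=
  ∀ X Y : C, ScottContinuous (fun f : X ⟶ Y => F.map f)

/-- A functor is locally strict if it preserves least morphisms. -/
def IsLocallyStrict {C : Type u} [Category.{v} C] [∀ X Y : C, PartialOrder (X ⟶ Y)]
    {D : Type u'} [Category.{v'} D] [∀ X Y : D, PartialOrder (X ⟶ Y)] (F : C ⥤ D) : Prop :=
  ∀ (X Y : C) (b : X ⟶ Y), IsBot b → IsBot (F.map b)

/-- `C` is algebraically compact for the class `L` of endofunctors: every `F` in `L` has a fixpoint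
`e : F A ≅ A` such that `(A, e)` is an initial algebra and `(A, e⁻¹)` is a final coalgebra. -/
def IsAlgebraicallyCompactFor (C : Type u) [Category.{v} C] (L : (C ⥤ C) → Prop) : Prop :=
  ∀ F : C ⥤ C, L F → ∃ (A : C) (e : F.obj A ≅ A),
    Nonempty (IsInitial (⟨A, e.hom⟩ : Endofunctor.Algebra F)) ∧
    Nonempty (IsTerminal (⟨A, e.inv⟩ : Endofunctor.Coalgebra F))

/-! ## Pointed dcpos and strict Scott-continuous maps -/

/-- The objects of the category of pointed dcpos. In Mathlib's `CompletePartialOrder` every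
directed set, also the empty one, has a supremum, so there is a least element `⊥`. -/
structure DcpoBot : Type (u + 1) where
  carrier : Type u
  [order : CompletePartialOrder carrier]

namespace DcpoBot

attribute [instance] DcpoBot.order

/-- Strict Scott-continuous maps. -/
@[ext]
structure Hom (X Y : DcpoBot.{u}) : Type u where
  toFun : X.carrier → Y.carrier
  scottContinuous : ScottContinuous toFun
  strict : toFun ⊥ = ⊥

instance : Category.{u} DcpoBot.{u} where
  Hom := Hom
  id X := ⟨id, ScottContinuous.id, rfl⟩
  comp f g := ⟨g.toFun ∘ f.toFun, f.scottContinuous.comp g.scottContinuous, by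
    simp [f.strict, g.strict]⟩

/-- Morphisms are ordered pointwise. -/
instance (X Y : DcpoBot.{u}) : PartialOrder (X ⟶ Y) :=
  PartialOrder.lift (fun f : Hom X Y => f.toFun) (fun _ _ h => Hom.ext h)

end DcpoBot

/-! ## Kegelspitzen -/

/-- A Kegelspitze: a pointed dcpo with a convex structure, all of whose operations
`(x₁, …, xₙ) ↦ ∑ rᵢ xᵢ` (for `rᵢ ≥ 0` and `∑ rᵢ = 1`) are Scott-continuous, and for which the scalar
multiplication `(c, x) ↦ c · x = c x + (1 - c) ⊥` is Scott-continuous on `[0,1] × X`. -/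
class IsKegelspitze (X : Type u) [CompletePartialOrder X] [Convexity.ConvexSpace ℝ X] : Prop where
  scottContinuous_convexComb : ∀ (n : ℕ) (r : Convexity.StdSimplex ℝ (Fin n)),
    ScottContinuous (fun x : Fin n → X => Convexity.iConvexComb r x)
  scottContinuous_scale : ScottContinuous (fun p : Set.Icc (0 : ℝ) 1 × X =>
    Convexity.convexCombPair (p.1 : ℝ) (1 - (p.1 : ℝ)) p.1.2.1 (sub_nonneg.2 p.1.2.2)
      (add_sub_cancel _ _) p.2 ⊥)

/-- The objects of the category of Kegelspitzen. -/
structure KS : Type (u + 1) where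
  carrier : Type u
  [order : CompletePartialOrder carrier]
  [convex : Convexity.ConvexSpace ℝ carrier]
  [isKegelspitze : IsKegelspitze carrier]

namespace KS

attribute [instance] KS.order KS.convex KS.isKegelspitze

/-- Affine strict Scott-continuous maps. -/
@[ext]
structure Hom (X Y : KS.{u}) : Type u where
  toFun : X.carrier → Y.carrier
  isAffine : Convexity.IsAffineMap ℝ toFun
  scottContinuous : ScottContinuous toFun
  strict : toFun ⊥ = ⊥

instance : Category.{u} KS.{u} where
  Hom := Hom
  id X := ⟨id, Convexity.IsAffineMap.id, ScottContinuous.id, rfl⟩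
  comp f g := ⟨g.toFun ∘ f.toFun, g.isAffine.comp f.isAffine,
    f.scottContinuous.comp g.scottContinuous, by simp [f.strict, g.strict]⟩

/-- Morphisms are ordered pointwise. -/
instance (X Y : KS.{u}) : PartialOrder (X ⟶ Y) :=
  PartialOrder.lift (fun f : Hom X Y => f.toFun) (fun _ _ h => Hom.ext h)

end KS

/-! ## The Lawvere theory of subconvex sets and its models -/

/-- The objects of the Lawvere theory of subconvex sets: natural numbers. -/
structure SubconvexTheory : Type where
  arity : ℕ

namespace SubconvexTheory

/-- A morphism `n ⟶ m` is a family of `m` subprobability distributions on `n` elements, that is,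
an `m × n` matrix of non-negative reals in which the entries of each of the `m` distributions
sum up to at most `1`. -/
@[ext]
structure Hom (n m : SubconvexTheory) : Type where
  mat : Matrix (Fin m.arity) (Fin n.arity) ℝ≥0
  sum_le_one : ∀ i, ∑ j, mat i j ≤ 1

/-- Composition is matrix multiplication, i.e. composition in the opposite of the Kleisli category
of the subdistribution monad. -/
instance : Category.{0} SubconvexTheory where
  Hom := Hom
  id n := ⟨1, fun i => by simp [Matrix.one_apply]⟩
  comp {n m k} A B := ⟨B.mat * A.mat, fun i => by
    calc ∑ j, (B.mat * A.mat) i j = ∑ l, B.mat i l * ∑ j, A.mat l j := by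
          simp only [Matrix.mul_apply, Finset.mul_sum]
          exact Finset.sum_comm
      _ ≤ ∑ l, B.mat i l * 1 := by
          gcongr with l
          exact A.sum_le_one l
      _ ≤ 1 := by simpa using B.sum_le_one i⟩
  id_comp A := Hom.ext (Matrix.mul_one A.mat)
  comp_id A := Hom.ext (Matrix.one_mul A.mat)
  assoc A B C := Hom.ext (Matrix.mul_assoc C.mat B.mat A.mat).symm

/-- Morphisms are ordered entrywise. -/
instance (n m : SubconvexTheory) : PartialOrder (n ⟶ m) :=
  PartialOrder.lift (fun A : Hom n m => (fun i j => A.mat i j : Fin m.arity → Fin n.arity → ℝ≥0))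
    (fun _ _ h => Hom.ext h)

/-- The models of the theory in pointed dcpos: locally strict Scott-continuous functors that
preserve finite products. -/
def isModel : ObjectProperty (SubconvexTheory ⥤ DcpoBot.{u}) := fun F =>
  PreservesFiniteProducts F ∧ IsLocallyContinuous F ∧ IsLocallyStrict F

/-- The category of models and natural transformations. -/
abbrev Models : Type (u + 1) := isModel.{u}.FullSubcategory

/-- Natural transformations are ordered pointwise. -/
instance (M N : Models.{u}) : PartialOrder (M ⟶ N) :=
  PartialOrder.lift
    (fun f => (fun n => f.hom.app n : ∀ n : SubconvexTheory, M.obj.obj n ⟶ N.obj.obj n))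
    (fun _ _ h => ObjectProperty.hom_ext _ (NatTrans.ext h))

end SubconvexTheory

end

/-! Algebraic compactness is the limit-colimit coincidence. Suppose `C` is enriched, has an object
`Z` with least identity, and has sequential limits that also reflect the order. For locally
continuous `F`, the limit `A` of `Z ← F Z ← F² Z ← ⋯` carries embeddings `i n : Fⁿ Z ⟶ A` with `⨆ π
n ≫ i n = 𝟙 A`. Local continuity turns this supremum into an isomorphism `e : F A ≅ A`, along which
`𝟙 A` is the supremum of the iterates of `h ↦ e⁻¹ ≫ F h ≫ e` at the least morphism. Every algebra
morphism out of `A` and every coalgebra morphism into `A` is then forced to be a least fixed point,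
which exists by Kleene iteration (`isInitial_and_isTerminal_of_isLUB_iterate`,
`isAlgebraicallyCompactFor_isLocallyContinuous`).

`KS` meets these conditions: pointwise directed suprema of morphisms are morphisms, since convex
combinations are Scott-continuous (`isAffineMap_of_isLUB_apply`), and compatible sequences form a
sub-Kegelspitze of the product.

The equivalence sends `X` to `n ↦ Xⁿ`, a matrix acting by subconvex combinations with the missing
mass on `⊥`. Continuity in the matrix follows from continuity of scalar multiplication
(`isLUB_subComb`). Naturality at projections and rows makes the functor full. Conversely, product
preservation makes each `M n` a power of `M 1`, and the rows make `M 1` a convex space; local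
strictness identifies the missing mass with `⊥`, and local continuity gives continuity of scalar
multiplication. As the equivalence preserves and reflects the order, the models inherit everything
from `KS`. -/

noncomputable section

/-! ## Scott-continuity along sequences -/

lemma ScottContinuous.isLUB_range_comp {α β : Type*} [Preorder α] [Preorder β] {f : α → β}
    (hf : ScottContinuous f) {c : ℕ → α} (hc : Monotone c) {a : α}
    (ha : IsLUB (Set.range c) a) : IsLUB (Set.range fun n => f (c n)) (f a) := by
  have h := hf (Set.range_nonempty c) (directedOn_range.2 hc.directed_le) ha
  rwa [← Set.range_comp] at h

lemma isLUB_range_succ {α : Type*} [Preorder α] {c : ℕ → α} (hc : Monotone c) {a : α}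
    (ha : IsLUB (Set.range c) a) : IsLUB (Set.range fun n => c (n + 1)) a := by
  refine ⟨?_, fun b hb => ha.2 ?_⟩
  · rintro _ ⟨n, rfl⟩
    exact ha.1 ⟨n + 1, rfl⟩
  · rintro _ ⟨n, rfl⟩
    exact (hc n.le_succ).trans (hb ⟨n, rfl⟩)

/-! ## Least morphisms -/

namespace IsDcpoBotEnriched

variable {C : Type u} [Category.{v} C] [∀ X Y : C, PartialOrder (X ⟶ Y)]

lemma exists_isBot (hC : IsDcpoBotEnriched C) (X Y : C) : ∃ b : X ⟶ Y, IsBot b := by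
  obtain ⟨b, hb⟩ := hC.exists_isLUB X Y ∅ (by intro x hx; exact hx.elim)
  exact ⟨b, isLUB_empty_iff.1 hb⟩

/-- The least morphism between two objects. -/
def bot (hC : IsDcpoBotEnriched C) (X Y : C) : X ⟶ Y := (hC.exists_isBot X Y).choose

lemma bot_le (hC : IsDcpoBotEnriched C) {X Y : C} (f : X ⟶ Y) : hC.bot X Y ≤ f :=
  (hC.exists_isBot X Y).choose_spec f

lemma eq_bot (hC : IsDcpoBotEnriched C) {X Y : C} {f : X ⟶ Y} (hf : IsBot f) : f = hC.bot X Y :=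
  le_antisymm (hf _) (hC.bot_le f)

@[simp]
lemma bot_comp (hC : IsDcpoBotEnriched C) {X Y Z : C} (g : Y ⟶ Z) :
    hC.bot X Y ≫ g = hC.bot X Z :=
  hC.eq_bot (hC.postcomp_strict _ _ _ _ g fun f => hC.bot_le f)

@[simp]
lemma comp_bot (hC : IsDcpoBotEnriched C) {X Y Z : C} (f : X ⟶ Y) :
    f ≫ hC.bot Y Z = hC.bot X Z :=
  hC.eq_bot (hC.precomp_strict _ _ _ f _ fun f => hC.bot_le f)

lemma comp_mono (hC : IsDcpoBotEnriched C) {X Y Z : C} {f f' : X ⟶ Y} {g g' : Y ⟶ Z}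
    (hf : f ≤ f') (hg : g ≤ g') : f ≫ g ≤ f' ≫ g' :=
  ((hC.precomp_scottContinuous _ _ _ f).monotone hg).trans
    ((hC.postcomp_scottContinuous _ _ _ g').monotone hf)

/-- Every morphism into `Z` factors through the least morphism `𝟙 Z`, hence is least by strictness.
This makes `Z` terminal. -/
lemma eq_of_isBot_id_right (hC : IsDcpoBotEnriched C) {X Z : C} (hZ : IsBot (𝟙 Z))
    (f g : X ⟶ Z) : f = g := by
  rw [← Category.comp_id f, ← Category.comp_id g, hC.eq_bot hZ, hC.comp_bot, hC.comp_bot]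

lemma exists_isLUB_range (hC : IsDcpoBotEnriched C) {X Y : C} {c : ℕ → (X ⟶ Y)}
    (hc : Monotone c) : ∃ f, IsLUB (Set.range c) f :=
  hC.exists_isLUB X Y _ (directedOn_range.2 hc.directed_le)

/-- The least fixed point of a Scott-continuous operator on a hom-set. -/
lemma exists_fixedPoint (hC : IsDcpoBotEnriched C) {X Y : C} {Ψ : (X ⟶ Y) → (X ⟶ Y)}
    (hΨ : ScottContinuous Ψ) :
    ∃ h, Ψ h = h ∧ IsLUB (Set.range fun n => Ψ^[n] (hC.bot X Y)) h := by
  have hmono : Monotone fun n => Ψ^[n] (hC.bot X Y) := by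
    refine monotone_nat_of_le_succ fun n => ?_
    induction n with
    | zero => exact hC.bot_le _
    | succ n ih =>
      simp only [Function.iterate_succ_apply'] at ih ⊢
      exact hΨ.monotone ih
  obtain ⟨h, hh⟩ := hC.exists_isLUB_range hmono
  refine ⟨h, ?_, hh⟩
  have h1 := hΨ.isLUB_range_comp hmono hh
  have h2 := isLUB_range_succ hmono hh
  simp only [Function.iterate_succ_apply'] at h2
  exact h1.unique h2

end IsDcpoBotEnriched

/-! ## Algebraic compactness -/

/-- Every inverse sequence in `C` has a limit whose universal property also holds for the order of
the hom-sets. -/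
def HasOrderedSequentialLimits (C : Type u) [Category.{v} C]
    [∀ X Y : C, PartialOrder (X ⟶ Y)] : Prop :=
  ∀ (D : ℕ → C) (p : ∀ n, D (n + 1) ⟶ D n), ∃ (A : C) (π : ∀ n, A ⟶ D n),
    (∀ n, π (n + 1) ≫ p n = π n) ∧
    (∀ (B : C) (f : ∀ n, B ⟶ D n), (∀ n, f (n + 1) ≫ p n = f n) →
      ∃ g : B ⟶ A, ∀ n, g ≫ π n = f n) ∧
    ∀ (B : C) (f g : B ⟶ A), (∀ n, f ≫ π n ≤ g ≫ π n) → f ≤ g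

section AlgebraicCompactness

variable {C : Type u} [Category.{v} C] [∀ X Y : C, PartialOrder (X ⟶ Y)]

/-- A fixed point of a locally continuous functor is an initial algebra and a final coalgebra as
soon as its identity is the supremum of the iterates of `h ↦ e⁻¹ ≫ F h ≫ e` on the least
morphism. -/
lemma isInitial_and_isTerminal_of_isLUB_iterate (hC : IsDcpoBotEnriched C) {F : C ⥤ C}
    (hF : IsLocallyContinuous F) {A : C} (e : F.obj A ≅ A)
    (he : IsLUB (Set.range fun n => (fun h => e.inv ≫ F.map h ≫ e.hom)^[n] (hC.bot A A)) (𝟙 A)) :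
    Nonempty (IsInitial (⟨A, e.hom⟩ : Endofunctor.Algebra F)) ∧
    Nonempty (IsTerminal (⟨A, e.inv⟩ : Endofunctor.Coalgebra F)) := by
  have hop {X Y X' Y' : C} (a : X' ⟶ F.obj X) (b : F.obj Y ⟶ Y') :
      ScottContinuous fun h : X ⟶ Y => a ≫ F.map h ≫ b :=
    (hF X Y).comp
      ((hC.postcomp_scottContinuous _ _ _ b).comp (hC.precomp_scottContinuous _ _ _ a))
  have hmono : Monotone fun n => (fun h => e.inv ≫ F.map h ≫ e.hom)^[n] (hC.bot A A) := by
    refine monotone_nat_of_le_succ fun n => ?_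
    induction n with
    | zero => exact hC.bot_le _
    | succ n ih =>
      simp only [Function.iterate_succ_apply'] at ih ⊢
      exact (hop _ _).monotone ih
  constructor
  -- Write `h = 𝟙 A ≫ h` and expand `𝟙 A` as the supremum `he`. The algebra square turns each
  -- iterate on `A` followed by `h` into the same iterate for `B`, so `h` must be the least fixed
  -- point.
  · have uniq (B : Endofunctor.Algebra F) (h : A ⟶ B.a) (hh : F.map h ≫ B.str = e.hom ≫ h) :
        IsLUB (Set.range fun n => (fun h => e.inv ≫ F.map h ≫ B.str)^[n] (hC.bot A B.a)) h := by
      have h1 := (hC.postcomp_scottContinuous _ _ _ h).isLUB_range_comp hmono he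
      rw [Category.id_comp] at h1
      convert h1 using 3 with n
      induction n with
      | zero => simp
      | succ n ih => simp only [Function.iterate_succ_apply', ih, Functor.map_comp,
          Category.assoc, hh]
    have hex (B : Endofunctor.Algebra F) := hC.exists_fixedPoint (hop e.inv B.str)
    refine ⟨IsInitial.ofUniqueHom (fun B => ⟨(hex B).choose, ?_⟩) fun B m => ?_⟩
    · have := (hex B).choose_spec.1
      exact (Iso.inv_comp_eq e).1 this
    · exact Endofunctor.Algebra.Hom.ext ((uniq B m.f m.h).unique (hex B).choose_spec.2)
  · have uniq (B : Endofunctor.Coalgebra F) (h : B.V ⟶ A) (hh : B.str ≫ F.map h = h ≫ e.inv) :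
        IsLUB (Set.range fun n => (fun h => B.str ≫ F.map h ≫ e.hom)^[n] (hC.bot B.V A)) h := by
      have h1 := (hC.precomp_scottContinuous _ _ _ h).isLUB_range_comp hmono he
      rw [Category.comp_id] at h1
      convert h1 using 3 with n
      induction n with
      | zero => simp
      | succ n ih => simp only [Function.iterate_succ_apply', ih, Functor.map_comp,
          Category.assoc, reassoc_of% hh]
    have hex (B : Endofunctor.Coalgebra F) := hC.exists_fixedPoint (hop B.str e.hom)
    refine ⟨IsTerminal.ofUniqueHom (fun B => ⟨(hex B).choose, ?_⟩) fun B m => ?_⟩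
    · have := (hex B).choose_spec.1
      refine (Iso.eq_comp_inv e).2 ?_
      simpa using this
    · exact Endofunctor.Coalgebra.Hom.ext ((uniq B m.f m.h).unique (hex B).choose_spec.2)

/-- The iterates of an endofunctor on an object. -/
def iterateObj (F : C ⥤ C) (Z : C) : ℕ → C
  | 0 => Z
  | n + 1 => F.obj (iterateObj F Z n)

/-- The embeddings and projections between the iterates of an endofunctor. -/
def iterateTrans (hC : IsDcpoBotEnriched C) (F : C ⥤ C) (Z : C) :
    ∀ n m : ℕ, iterateObj F Z n ⟶ iterateObj F Z m
  | 0, _ => hC.bot _ _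
  | _ + 1, 0 => hC.bot _ _
  | n + 1, m + 1 => F.map (iterateTrans hC F Z n m)

variable (hC : IsDcpoBotEnriched C) (F : C ⥤ C) {Z : C}

lemma iterateTrans_zero_left (m : ℕ) : iterateTrans hC F Z 0 m = hC.bot _ _ := by
  rw [iterateTrans]

lemma iterateTrans_succ_succ (n m : ℕ) :
    iterateTrans hC F Z (n + 1) (m + 1) = F.map (iterateTrans hC F Z n m) := by
  rw [iterateTrans]

lemma iterateTrans_self (hZ : IsBot (𝟙 Z)) (n : ℕ) : iterateTrans hC F Z n n = 𝟙 _ := by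
  induction n with
  | zero => rw [iterateTrans_zero_left]; exact (hC.eq_bot hZ).symm
  | succ n ih => rw [iterateTrans_succ_succ, ih, F.map_id]; rfl

/-- Transition morphisms compose, unless the intermediate index is smaller than both ends. -/
lemma iterateTrans_comp (hZ : IsBot (𝟙 Z)) {n k m : ℕ} (h : n ≤ k ∨ m ≤ k) :
    iterateTrans hC F Z n k ≫ iterateTrans hC F Z k m = iterateTrans hC F Z n m := by
  induction k generalizing n m with
  | zero =>
    rcases h with h | h
    · obtain rfl : n = 0 := by omega
      simp [iterateTrans_zero_left]
    · obtain rfl : m = 0 := by omega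
      exact hC.eq_of_isBot_id_right hZ _ _
  | succ k ih =>
    cases n with
    | zero => simp [iterateTrans_zero_left]
    | succ n =>
      cases m with
      | zero => exact hC.eq_of_isBot_id_right hZ _ _
      | succ m =>
        rw [iterateTrans_succ_succ, iterateTrans_succ_succ, iterateTrans_succ_succ,
          ← ih (n := n) (m := m) (by omega), F.map_comp]
        rfl

/-- At stage `0` the composite passes through `Z` and is least; monotonicity of `F` on hom-sets
propagates the inequality. -/
lemma iterateTrans_proj_emb_le (hF : IsLocallyContinuous F) (n : ℕ) :
    iterateTrans hC F Z (n + 1) n ≫ iterateTrans hC F Z n (n + 1) ≤ 𝟙 _ := by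
  induction n with
  | zero => simp [iterateTrans_zero_left, hC.bot_le]
  | succ n ih =>
    rw [iterateTrans_succ_succ, iterateTrans_succ_succ]
    refine le_of_eq_of_le (F.map_comp _ _).symm ?_
    exact ((hF _ _).monotone ih).trans_eq (F.map_id _)

theorem isAlgebraicallyCompactFor_isLocallyContinuous (hC : IsDcpoBotEnriched C)
    (hZ : ∃ Z : C, IsBot (𝟙 Z)) (hL : HasOrderedSequentialLimits C) :
    IsAlgebraicallyCompactFor C fun F => IsLocallyContinuous F := by
  intro F hF
  obtain ⟨Z, hZ⟩ := hZ
  obtain ⟨A, π, hπ, lift, ord⟩ := hL (iterateObj F Z) fun n => iterateTrans hC F Z (n + 1) n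
  have ext {B : C} {f g : B ⟶ A} (h : ∀ n, f ≫ π n = g ≫ π n) : f = g :=
    le_antisymm (ord B f g fun n => (h n).le) (ord B g f fun n => (h n).ge)
  -- The embeddings into the limit: the transition morphisms out of stage `n` form a cone.
  choose i hi using fun n => lift _ (iterateTrans hC F Z n) fun m =>
    iterateTrans_comp hC F hZ (by omega)
  have hπ_trans {n m : ℕ} (h : m ≤ n) : π n ≫ iterateTrans hC F Z n m = π m := by
    induction n, h using Nat.le_induction with
    | base => rw [iterateTrans_self hC F hZ, Category.comp_id]
    | succ n h ih =>
      rw [← iterateTrans_comp hC F hZ (n := n + 1) (k := n) (m := m) (by omega),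
        ← Category.assoc, hπ, ih]
  have htrans_i (n : ℕ) : iterateTrans hC F Z n (n + 1) ≫ i (n + 1) = i n :=
    ext fun m => by rw [Category.assoc, hi, hi, iterateTrans_comp hC F hZ (by omega)]
  have hπi_mono : Monotone fun n => π n ≫ i n := by
    refine monotone_nat_of_le_succ fun n => ?_
    rw [← hπ n, ← htrans_i n]
    simpa using hC.comp_mono (le_refl (π (n + 1)))
      (hC.comp_mono (iterateTrans_proj_emb_le hC F hF n) (le_refl (i (n + 1))))
  -- Order-reflection lets both halves be tested after each `π m`, and `π n ≫ i n ≫ π m = π m` once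
  -- `n ≥ m`.
  have hπi_lub : IsLUB (Set.range fun n => π n ≫ i n) (𝟙 A) := by
    constructor
    · rintro _ ⟨n, rfl⟩
      refine ord _ _ _ fun m => ?_
      calc (π n ≫ i n) ≫ π m ≤ (π (max n m) ≫ i (max n m)) ≫ π m :=
            hC.comp_mono (hπi_mono (le_max_left n m)) le_rfl
        _ = 𝟙 A ≫ π m := by
            rw [Category.assoc, hi, hπ_trans (le_max_right n m), Category.id_comp]
    · intro f hf
      refine ord _ _ _ fun m => ?_
      calc 𝟙 A ≫ π m = (π m ≫ i m) ≫ π m := by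
            rw [Category.assoc, hi, iterateTrans_self hC F hZ, Category.comp_id, Category.id_comp]
        _ ≤ f ≫ π m := hC.comp_mono (hf ⟨m, rfl⟩) le_rfl
  -- The sequences shifted by one, typed over `F.obj (iterateObj F Z n)` so that they compose with
  -- images under `F`.
  let t (n m : ℕ) := iterateTrans hC F Z n m
  let πs (n : ℕ) : A ⟶ F.obj (iterateObj F Z n) := π (n + 1)
  let is (n : ℕ) : F.obj (iterateObj F Z n) ⟶ A := i (n + 1)
  have hts (n m : ℕ) : is n ≫ πs m = F.map (t n m) :=
    (hi (n + 1) (m + 1)).trans (iterateTrans_succ_succ hC F n m)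
  have hπs (n : ℕ) : πs (n + 1) ≫ F.map (t (n + 1) n) = πs n := by
    have := hπ (n + 1)
    rwa [iterateTrans_succ_succ] at this
  -- The cone of the `F.map (π n)`, placed at index `n + 1`; the leg at `0` is forced because `Z` is
  -- terminal.
  obtain ⟨a, ha⟩ := lift (F.obj A)
    (fun | 0 => hC.bot _ _ | n + 1 => F.map (π n)) (by
      rintro (_ | n)
      · exact hC.eq_of_isBot_id_right hZ _ _
      · change F.map (π (n + 1)) ≫ iterateTrans hC F Z (n + 2) (n + 1) = F.map (π n)
        rw [iterateTrans_succ_succ, ← hπ n, F.map_comp]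
        rfl)
  have ha_succ (n : ℕ) : a ≫ πs n = F.map (π n) := ha (n + 1)
  have hia (n : ℕ) : F.map (i n) ≫ a = is n := by
    refine ext fun m => ?_
    cases m with
    | zero => exact hC.eq_of_isBot_id_right hZ _ _
    | succ m =>
      change (F.map (i n) ≫ a) ≫ πs m = is n ≫ πs m
      rw [Category.assoc, ha_succ, ← F.map_comp, hi, hts]
  have hb_mono : Monotone fun n => πs n ≫ F.map (i n) := by
    refine monotone_nat_of_le_succ fun n => ?_
    rw [← hπs n, ← htrans_i n, F.map_comp, Category.assoc, ← F.map_comp_assoc]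
    refine hC.comp_mono le_rfl ((hC.comp_mono ((hF _ _).monotone
      (iterateTrans_proj_emb_le hC F hF n)) (le_refl (F.map (i (n + 1))))).trans_eq ?_)
    simp
  -- The candidate inverse of `a`. Composing on one side gives `⨆ F (π n ≫ i n) = F 𝟙` by local
  -- continuity, on the other the shifted supremum `⨆ π (n + 1) ≫ i (n + 1) = 𝟙`.
  obtain ⟨b, hb⟩ := hC.exists_isLUB_range hb_mono
  have hab : a ≫ b = 𝟙 _ := by
    have h1 := (hC.precomp_scottContinuous _ _ _ a).isLUB_range_comp hb_mono hb
    have h2 := (hF _ _).isLUB_range_comp hπi_mono hπi_lub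
    simp only [← Category.assoc, ha_succ] at h1
    simp only [F.map_comp, F.map_id] at h2
    exact h1.unique h2
  have hba : b ≫ a = 𝟙 _ := by
    have h1 := (hC.postcomp_scottContinuous _ _ _ a).isLUB_range_comp hb_mono hb
    have h2 := isLUB_range_succ hπi_mono hπi_lub
    simp only [Category.assoc, hia] at h1
    exact h1.unique h2
  refine ⟨A, ⟨a, b, hab, hba⟩, isInitial_and_isTerminal_of_isLUB_iterate hC hF _ ?_⟩
  -- The `n`-th iterate at the least morphism is exactly `π n ≫ i n`.
  convert hπi_lub using 3 with n
  induction n with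
  | zero =>
    rw [hC.eq_of_isBot_id_right hZ (π 0) (hC.bot _ _)]
    exact (hC.bot_comp _).symm
  | succ n ih =>
    have hbπ : b ≫ F.map (π n) = πs n := by
      rw [← ha_succ, ← Category.assoc, hba, Category.id_comp]
    rw [Function.iterate_succ_apply', ih, F.map_comp, Category.assoc, hia, ← Category.assoc, hbπ]
    rfl

end AlgebraicCompactness

/-! ## Transport along order-reflecting equivalences -/

section Transport

variable {C : Type u} [Category.{v} C] [∀ X Y : C, PartialOrder (X ⟶ Y)]
  {D : Type u'} [Category.{v'} D] [∀ X Y : D, PartialOrder (X ⟶ Y)]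
  (G : D ⥤ C) [G.Full] [G.Faithful]

/-- A fully faithful functor that preserves and reflects the order is an order isomorphism on
hom-sets. -/
def homOrderIso (hG : ∀ (X Y : D) (f g : X ⟶ Y), f ≤ g ↔ G.map f ≤ G.map g) (X Y : D) :
    (X ⟶ Y) ≃o (G.obj X ⟶ G.obj Y) where
  toEquiv := (Functor.FullyFaithful.ofFullyFaithful G).homEquiv
  map_rel_iff' := (hG X Y _ _).symm

lemma homOrderIso_apply (hG : ∀ (X Y : D) (f g : X ⟶ Y), f ≤ g ↔ G.map f ≤ G.map g) {X Y : D}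
    (f : X ⟶ Y) : homOrderIso G hG X Y f = G.map f := rfl

lemma OrderIso.scottContinuous {α β : Type*} [Preorder α] [Preorder β] (e : α ≃o β) :
    ScottContinuous e := fun _ _ _ _ ha => e.isLUB_image'.2 ha

theorem IsDcpoBotEnriched.of_fullyFaithful (hC : IsDcpoBotEnriched C)
    (hG : ∀ (X Y : D) (f g : X ⟶ Y), f ≤ g ↔ G.map f ≤ G.map g) : IsDcpoBotEnriched D := by
  have hbot {X Y : D} (f : X ⟶ Y) : IsBot f ↔ IsBot (G.map f) :=
    ⟨fun h g => by
      obtain ⟨g, rfl⟩ := G.map_surjective g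
      exact (hG _ _ _ _).1 (h g), fun h g => (hG _ _ _ _).2 (h _)⟩
  constructor
  · intro X Y d hd
    obtain ⟨f, hf⟩ := hC.exists_isLUB _ _ (homOrderIso G hG X Y '' d)
      ((directedOn_image).2 (hd.mono fun _ _ h => (homOrderIso G hG X Y).monotone h))
    exact ⟨_, (homOrderIso G hG X Y).isLUB_image.1 hf⟩
  · intro X Y Z f
    convert (homOrderIso G hG Y Z).scottContinuous.comp
      ((hC.precomp_scottContinuous _ _ _ (G.map f)).comp
        (homOrderIso G hG X Z).symm.scottContinuous) using 1
    ext g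
    exact ((homOrderIso G hG X Z).symm_apply_eq.2 (by simp [homOrderIso_apply])).symm
  · intro X Y Z g
    convert (homOrderIso G hG X Y).scottContinuous.comp
      ((hC.postcomp_scottContinuous _ _ _ (G.map g)).comp
        (homOrderIso G hG X Z).symm.scottContinuous) using 1
    ext f
    exact ((homOrderIso G hG X Z).symm_apply_eq.2 (by simp [homOrderIso_apply])).symm
  · intro X Y Z f b hb
    rw [hbot, G.map_comp]
    exact hC.precomp_strict _ _ _ _ _ ((hbot b).1 hb)
  · intro X Y Z b g hb
    rw [hbot, G.map_comp]
    exact hC.postcomp_strict _ _ _ _ _ ((hbot b).1 hb)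

variable [G.EssSurj]

omit [G.Full] [G.Faithful] in
lemma exists_isBot_id_of_essSurj (hC : IsDcpoBotEnriched C)
    (hG : ∀ (X Y : D) (f g : X ⟶ Y), f ≤ g ↔ G.map f ≤ G.map g)
    (hZ : ∃ Z : C, IsBot (𝟙 Z)) : ∃ Z : D, IsBot (𝟙 Z) := by
  obtain ⟨Z, hZ⟩ := hZ
  let e := G.objObjPreimageIso Z
  refine ⟨G.objPreimage Z, fun f => (hG _ _ _ _).2 ?_⟩
  have h : G.map (𝟙 (G.objPreimage Z)) = e.hom ≫ 𝟙 Z ≫ e.inv := by simp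
  rw [h]
  exact hC.precomp_strict _ _ _ _ _ (hC.postcomp_strict _ _ _ _ _ hZ) _

lemma HasOrderedSequentialLimits.of_essSurj (hC : IsDcpoBotEnriched C)
    (hG : ∀ (X Y : D) (f g : X ⟶ Y), f ≤ g ↔ G.map f ≤ G.map g)
    (hL : HasOrderedSequentialLimits C) : HasOrderedSequentialLimits D := by
  intro S p
  obtain ⟨A, π, hπ, lift, ord⟩ := hL (fun n => G.obj (S n)) fun n => G.map (p n)
  let e := G.objObjPreimageIso A
  refine ⟨G.objPreimage A, fun n => G.preimage (e.hom ≫ π n), fun n => G.map_injective ?_,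
    fun B f hf => ?_, fun B f g h => (hG _ _ _ _).2 ?_⟩
  · simp [hπ]
  · obtain ⟨g, hg⟩ := lift (G.obj B) (fun n => G.map (f n)) fun n => by rw [← G.map_comp, hf]
    exact ⟨G.preimage (g ≫ e.inv), fun n => G.map_injective (by simp [hg])⟩
  · have h1 : G.map f ≫ e.hom ≤ G.map g ≫ e.hom := ord _ _ _ fun n => by
      simpa using (hG _ _ _ _).1 (h n)
    simpa using hC.comp_mono h1 (le_refl e.inv)

end Transport

/-! ## Pointwise suprema of Scott-continuous maps -/

/-- The suprema over `S` and over `d` may be interchanged. -/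
lemma scottContinuous_of_isLUB_apply {α β : Type*} [Preorder α] [Preorder β] {d : Set (α → β)}
    (hd : ∀ f ∈ d, ScottContinuous f) {F : α → β}
    (hF : ∀ x, IsLUB ((fun f => f x) '' d) (F x)) : ScottContinuous F := by
  intro S hne hS a ha
  constructor
  · rintro _ ⟨x, hx, rfl⟩
    refine (hF x).2 ?_
    rintro _ ⟨f, hf, rfl⟩
    exact ((hd f hf).monotone (ha.1 hx)).trans ((hF a).1 ⟨f, hf, rfl⟩)
  · intro u hu
    refine (hF a).2 ?_
    rintro _ ⟨f, hf, rfl⟩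
    refine (hd f hf hne hS ha).2 ?_
    rintro _ ⟨x, hx, rfl⟩
    exact ((hF x).1 ⟨f, hf, rfl⟩).trans (hu ⟨x, hx, rfl⟩)

lemma scottContinuous_pi {α ι : Type*} {β : ι → Type*} [Preorder α] [∀ i, Preorder (β i)]
    {f : α → ∀ i, β i} (hf : ∀ i, ScottContinuous fun a => f a i) : ScottContinuous f := by
  intro S hne hS a ha
  refine isLUB_pi.2 fun i => ?_
  rw [Set.image_image]
  exact hf i hne hS ha

lemma scottContinuous_eval {ι : Type*} {β : ι → Type*} [∀ i, Preorder (β i)] (i : ι) :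
    ScottContinuous fun f : ∀ i, β i => f i :=
  fun _ _ _ _ ha => isLUB_pi.1 ha i

/-- Dependent products of pointed dcpos are pointed dcpos. -/
instance Pi.instCompletePartialOrder {ι : Type*} {β : ι → Type*}
    [∀ i, CompletePartialOrder (β i)] : CompletePartialOrder (∀ i, β i) where
  sSup d := fun i => sSup ((fun f => f i) '' d)
  lubOfDirected _ hd := isLUB_pi.2 fun i =>
    (directedOn_image.2 (hd.mono fun _ _ h => h i)).isLUB_sSup

namespace KS

lemma hom_ext {X Y : KS.{u}} {f g : X ⟶ Y} (h : ∀ x, f.toFun x = g.toFun x) : f = g :=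
  Hom.ext (funext h)

lemma le_def {X Y : KS.{u}} {f g : X ⟶ Y} : f ≤ g ↔ ∀ x, f.toFun x ≤ g.toFun x := Iff.rfl

end KS

namespace DcpoBot

lemma hom_ext {X Y : DcpoBot.{u}} {f g : X ⟶ Y} (h : ∀ x, f.toFun x = g.toFun x) : f = g :=
  Hom.ext (funext h)

lemma le_def {X Y : DcpoBot.{u}} {f g : X ⟶ Y} : f ≤ g ↔ ∀ x, f.toFun x ≤ g.toFun x := Iff.rfl

lemma directedOn_apply {X Y : DcpoBot.{u}} {d : Set (X ⟶ Y)} (hd : DirectedOn (· ≤ ·) d)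
    (x : X.carrier) : DirectedOn (· ≤ ·) ((fun f : X ⟶ Y => f.toFun x) '' d) :=
  directedOn_image.2 (hd.mono fun _ _ h => le_def.1 h x)

lemma isLUB_of_isLUB_apply {X Y : DcpoBot.{u}} {d : Set (X ⟶ Y)} {a : X ⟶ Y}
    (h : ∀ x, IsLUB ((fun f : X ⟶ Y => f.toFun x) '' d) (a.toFun x)) : IsLUB d a := by
  refine ⟨fun f hf x => (h x).1 ⟨f, hf, rfl⟩, fun g hg x => (h x).2 ?_⟩
  rintro _ ⟨f, hf, rfl⟩
  exact hg hf x

/-- The pointwise supremum is itself a morphism, so it must be the least upper bound. -/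
lemma isLUB_apply {X Y : DcpoBot.{u}} {d : Set (X ⟶ Y)} (hd : DirectedOn (· ≤ ·) d) {a : X ⟶ Y}
    (ha : IsLUB d a) (x : X.carrier) :
    IsLUB ((fun f : X ⟶ Y => f.toFun x) '' d) (a.toFun x) := by
  have hs (x : X.carrier) := (directedOn_apply hd x).isLUB_sSup
  let s : X ⟶ Y :=
    { toFun := fun x => sSup ((fun f : X ⟶ Y => f.toFun x) '' d)
      scottContinuous := scottContinuous_of_isLUB_apply (d := (fun f : X ⟶ Y => f.toFun) '' d)
        (by rintro _ ⟨f, -, rfl⟩; exact f.scottContinuous)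
        (by intro x; rw [Set.image_image]; exact hs x)
      strict := le_antisymm ((hs ⊥).2 (by rintro _ ⟨f, -, rfl⟩; exact f.strict.le)) bot_le }
  have hsa : s = a := (isLUB_of_isLUB_apply (a := s) hs).unique ha
  rw [← hsa]
  exact hs x

end DcpoBot

/-! ## Convex combinations in Kegelspitzen -/

namespace Convexity.StdSimplex

/-- Enumerating the finite support reduces convex combinations to those indexed by `Fin n`, the form
in which continuity is given. -/
lemma exists_eq_map_fin {M : Type*} (w : StdSimplex ℝ M) :
    ∃ (n : ℕ) (r : StdSimplex ℝ (Fin n)) (x : Fin n → M), w = r.map x := by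
  classical
  let e := w.weights.support.equivFin
  have hinj : Function.Injective fun i => ((e.symm i : w.weights.support) : M) :=
    Subtype.val_injective.comp e.symm.injective
  have hmap : (w.weights.comapDomain (fun i => (e.symm i : M)) hinj.injOn).mapDomain
      (fun i => (e.symm i : M)) = w.weights := by
    refine Finsupp.mapDomain_comapDomain _ hinj _ fun x hx => ⟨e ⟨x, hx⟩, by simp⟩
  refine ⟨_, ⟨w.weights.comapDomain (fun i => (e.symm i : M)) hinj.injOn, fun i => w.nonneg _, ?_⟩,
    fun i => e.symm i, StdSimplex.ext hmap.symm⟩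
  exact (Finsupp.sum_mapDomain_index (by simp) (by simp)).symm.trans
    ((congrArg (fun v : M →₀ ℝ => v.sum fun _ r => r) hmap).trans w.total)

end Convexity.StdSimplex

open Convexity

/-- Scott-continuity of each convex combination on `Yⁿ` lets it commute with the directed supremum.
The empty family is treated apart: its supremum is the constant map `⊥`. -/
lemma isAffineMap_of_isLUB_apply {X Y : Type*} [CompletePartialOrder Y]
    [ConvexSpace ℝ X] [ConvexSpace ℝ Y] [IsKegelspitze Y] {d : Set (X → Y)}
    (hd : DirectedOn (· ≤ ·) d) (haff : ∀ f ∈ d, IsAffineMap ℝ f) {F : X → Y}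
    (hF : ∀ x, IsLUB ((fun f => f x) '' d) (F x)) : IsAffineMap ℝ F := by
  rcases d.eq_empty_or_nonempty with rfl | hne
  · have : F = fun _ => ⊥ := funext fun x => by
      have := hF x
      rw [Set.image_empty, isLUB_empty_iff] at this
      exact this.eq_bot
    rw [this]
    exact IsAffineMap.const _
  · refine ⟨fun w => ?_⟩
    obtain ⟨n, r, x, rfl⟩ := w.exists_eq_map_fin
    have h1 : IsLUB ((fun f (i : Fin n) => f (x i)) '' d) fun i => F (x i) := by
      refine isLUB_pi.2 fun i => ?_
      rw [Set.image_image]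
      exact hF (x i)
    have h2 := IsKegelspitze.scottContinuous_convexComb n r (hne.image _)
      (directedOn_image.2 (hd.mono fun _ _ h i => h (x i))) h1
    rw [Set.image_image] at h2
    have h3 := hF (r.map x).sConvexComb
    have h4 : (fun f => f (r.map x).sConvexComb) '' d =
        (fun f => iConvexComb r fun i => f (x i)) '' d :=
      Set.image_congr fun f hf => (haff f hf).map_iConvexComb r x
    rw [h4] at h3
    rw [StdSimplex.map_map]
    exact h3.unique h2

/-! ### Enrichment of the category of Kegelspitzen by pointwise suprema -/

namespace KS

lemma directedOn_apply {X Y : KS.{u}} {d : Set (X ⟶ Y)} (hd : DirectedOn (· ≤ ·) d)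
    (x : X.carrier) : DirectedOn (· ≤ ·) ((fun f : X ⟶ Y => f.toFun x) '' d) :=
  directedOn_image.2 (hd.mono fun _ _ h => le_def.1 h x)

lemma isLUB_of_isLUB_apply {X Y : KS.{u}} {d : Set (X ⟶ Y)} {a : X ⟶ Y}
    (h : ∀ x, IsLUB ((fun f : X ⟶ Y => f.toFun x) '' d) (a.toFun x)) : IsLUB d a := by
  refine ⟨fun f hf x => (h x).1 ⟨f, hf, rfl⟩, fun g hg x => (h x).2 ?_⟩
  rintro _ ⟨f, hf, rfl⟩
  exact hg hf x

lemma exists_isLUB_apply {X Y : KS.{u}} {d : Set (X ⟶ Y)} (hd : DirectedOn (· ≤ ·) d) :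
    ∃ a : X ⟶ Y, ∀ x, IsLUB ((fun f : X ⟶ Y => f.toFun x) '' d) (a.toFun x) := by
  have hs (x : X.carrier) := (directedOn_apply hd x).isLUB_sSup
  exact ⟨{
    toFun := fun x => sSup ((fun f : X ⟶ Y => f.toFun x) '' d)
    isAffine := isAffineMap_of_isLUB_apply (d := (fun f : X ⟶ Y => f.toFun) '' d)
      (directedOn_image.2 hd) (by rintro _ ⟨f, -, rfl⟩; exact f.isAffine)
      (by intro x; rw [Set.image_image]; exact hs x)
    scottContinuous := scottContinuous_of_isLUB_apply (d := (fun f : X ⟶ Y => f.toFun) '' d)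
      (by rintro _ ⟨f, -, rfl⟩; exact f.scottContinuous)
      (by intro x; rw [Set.image_image]; exact hs x)
    strict := le_antisymm ((hs ⊥).2 (by rintro _ ⟨f, -, rfl⟩; exact f.strict.le)) bot_le }, hs⟩

lemma isLUB_apply {X Y : KS.{u}} {d : Set (X ⟶ Y)} (hd : DirectedOn (· ≤ ·) d) {a : X ⟶ Y}
    (ha : IsLUB d a) (x : X.carrier) :
    IsLUB ((fun f : X ⟶ Y => f.toFun x) '' d) (a.toFun x) := by
  obtain ⟨s, hs⟩ := exists_isLUB_apply hd
  rw [ha.unique (isLUB_of_isLUB_apply hs)]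
  exact hs x

lemma toFun_eq_bot_of_isBot {X Y : KS.{u}} {b : X ⟶ Y} (hb : IsBot b) (x : X.carrier) :
    b.toFun x = ⊥ := by
  have h := isLUB_apply (d := (∅ : Set (X ⟶ Y))) (by intro x hx; exact hx.elim)
    (isLUB_empty_iff.2 hb) x
  rw [Set.image_empty, isLUB_empty_iff] at h
  exact h.eq_bot

theorem isDcpoBotEnriched : IsDcpoBotEnriched KS.{u} where
  exists_isLUB X Y d hd := by
    obtain ⟨a, ha⟩ := exists_isLUB_apply hd
    exact ⟨a, isLUB_of_isLUB_apply ha⟩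
  precomp_scottContinuous X Y Z f d _ hd a ha := by
    refine isLUB_of_isLUB_apply fun x => ?_
    rw [Set.image_image]
    exact isLUB_apply hd ha (f.toFun x)
  postcomp_scottContinuous X Y Z g d hne hd a ha := by
    refine isLUB_of_isLUB_apply fun x => ?_
    have h := g.scottContinuous (hne.image _) (directedOn_apply hd x) (isLUB_apply hd ha x)
    rwa [Set.image_image] at h ⊢
  precomp_strict X Y Z f b hb g x := by
    exact (toFun_eq_bot_of_isBot hb _).trans_le bot_le
  postcomp_strict X Y Z b g hb f x := by
    exact ((congrArg g.toFun (toFun_eq_bot_of_isBot hb x)).trans g.strict).trans_le bot_le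

/-! ## The one-point Kegelspitze -/

/-- A one-point convex space. -/
instance instConvexSpacePUnit : ConvexSpace ℝ PUnit.{u + 1} :=
  .mk (fun _ => PUnit.unit) (fun _ => rfl) fun _ => rfl

instance instIsKegelspitzePUnit : IsKegelspitze PUnit.{u + 1} where
  scottContinuous_convexComb _ _ := ScottContinuous.const PUnit.unit
  scottContinuous_scale := ScottContinuous.const PUnit.unit

lemma exists_isBot_id : ∃ Z : KS.{u}, IsBot (𝟙 Z) :=
  ⟨⟨PUnit.{u + 1}⟩, fun _ _ => le_rfl⟩

/-! ## Limits of inverse sequences of Kegelspitzen -/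

section SequentialLimit

variable (D : ℕ → KS.{u}) (p : ∀ n, D (n + 1) ⟶ D n)

/-- The points of the limit of an inverse sequence. -/
def limitSet : Set (∀ n, (D n).carrier) := {x | ∀ n, (p n).toFun (x (n + 1)) = x n}

variable {D p}

/-- The bonding maps preserve nonempty directed suprema, and strictness covers the empty one. -/
lemma isLUB_mem_limitSet {d : Set (∀ n, (D n).carrier)} (hsub : d ⊆ limitSet D p)
    (hd : DirectedOn (· ≤ ·) d) {a : ∀ n, (D n).carrier} (ha : IsLUB d a) :
    a ∈ limitSet D p := by
  intro n
  rcases d.eq_empty_or_nonempty with rfl | hne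
  · have : a = ⊥ := (isLUB_empty_iff.1 ha).eq_bot
    rw [this]
    exact (p n).strict
  · have h := (p n).scottContinuous (hne.image fun f => f (n + 1))
      (directedOn_image.2 (hd.mono fun _ _ h => h (n + 1))) (isLUB_pi.1 ha (n + 1))
    rw [Set.image_image] at h
    refine h.unique ?_
    convert isLUB_pi.1 ha n using 1
    exact Set.image_congr fun f hf => hsub hf n

variable (D p)

lemma isConvexSet_limitSet : IsConvexSet ℝ (limitSet D p) := by
  intro w hw n
  rw [Pi.sConvexComb_apply, Pi.sConvexComb_apply, (p n).isAffine.map_iConvexComb]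
  refine iConvexComb_congr fun x hx => ?_
  exact hw (by simpa using hx) n

/-- The order of the limit. -/
instance : CompletePartialOrder (limitSet D p) := by
  classical
  have hlub (d : Set (limitSet D p)) (hd : DirectedOn (· ≤ ·) d) :
      ∃ a, IsLUB d a := by
    have hd' : DirectedOn (· ≤ ·) (Subtype.val '' d) := directedOn_image.2 hd
    have ha := hd'.isLUB_sSup
    refine ⟨⟨_, isLUB_mem_limitSet (by rintro _ ⟨x, -, rfl⟩; exact x.2) hd' ha⟩,
      fun x hx => ha.1 ⟨x, hx, rfl⟩, fun y hy => ha.2 ?_⟩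
    rintro _ ⟨x, hx, rfl⟩
    exact hy hx
  -- `sSup` has to be total; on sets without a supremum the constant sequence `⊥` is a junk value.
  letI : SupSet (limitSet D p) :=
    ⟨fun d => if h : ∃ a, IsLUB d a then h.choose else
      ⟨⊥, fun n => (p n).strict⟩⟩
  refine CompletePartialOrder.ofLubOfDirected _ fun d hd => ?_
  change IsLUB d (dite _ _ _)
  rw [dif_pos (hlub d hd)]
  exact (hlub d hd).choose_spec

/-- The convex structure of the limit. -/
instance : ConvexSpace ℝ (limitSet D p) := .subtype _ (isConvexSet_limitSet D p)

variable {D p}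

lemma limitSet_val_iConvexComb {I : Type*} (w : StdSimplex ℝ I) (f : I → limitSet D p) (n : ℕ) :
    (w.iConvexComb f).1 n = w.iConvexComb fun i => (f i).1 n := by
  rw [subtypeVal_iConvexComb _ (isConvexSet_limitSet D p), Pi.iConvexComb_apply]

lemma limitSet_val_convexCombPair (a b : ℝ) (ha hb hab) (x y : limitSet D p) (n : ℕ) :
    (convexCombPair a b ha hb hab x y).1 n = convexCombPair a b ha hb hab (x.1 n) (y.1 n) := by
  rw [subtypeVal_convexCombPair _ (isConvexSet_limitSet D p), Pi.convexCombPair_apply]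

lemma limitSet_val_bot (n : ℕ) : (⊥ : limitSet D p).1 n = ⊥ := by
  have h : (⊥ : limitSet D p) ≤ ⟨⊥, fun n => (p n).strict⟩ := bot_le
  exact le_bot_iff.1 (h n)

lemma scottContinuous_limitSet_val (n : ℕ) :
    ScottContinuous fun x : limitSet D p => x.1 n := by
  intro d hne hd a ha
  have hd' : DirectedOn (· ≤ ·) (Subtype.val '' d) := directedOn_image.2 hd
  have hs := hd'.isLUB_sSup
  have hmem := isLUB_mem_limitSet (by rintro _ ⟨x, -, rfl⟩; exact x.2) hd' hs
  have : a = ⟨_, hmem⟩ := ha.unique ⟨fun x hx => hs.1 ⟨x, hx, rfl⟩, fun y hy => hs.2 (by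
    rintro _ ⟨x, hx, rfl⟩
    exact hy hx)⟩
  have h := isLUB_pi.1 hs n
  rw [Set.image_image] at h
  rwa [this]

lemma scottContinuous_of_limitSet_val {α : Type*} [Preorder α] {f : α → limitSet D p}
    (hf : ∀ n, ScottContinuous fun a => (f a).1 n) : ScottContinuous f := by
  intro d hne hd a ha
  refine ⟨?_, fun y hy n => (hf n hne hd ha).2 ?_⟩
  · rintro _ ⟨x, hx, rfl⟩ n
    exact (hf n hne hd ha).1 ⟨x, hx, rfl⟩
  · rintro _ ⟨x, hx, rfl⟩
    exact hy ⟨x, hx, rfl⟩ n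

instance : IsKegelspitze (limitSet D p) where
  scottContinuous_convexComb n r := scottContinuous_of_limitSet_val fun k => by
    simp only [limitSet_val_iConvexComb]
    exact ScottContinuous.comp (f := fun (x : Fin n → limitSet D p) i => (x i).1 k)
      (scottContinuous_pi fun i => (scottContinuous_eval (β := fun _ => limitSet D p) i).comp
        (scottContinuous_limitSet_val k))
      (IsKegelspitze.scottContinuous_convexComb n r)
  scottContinuous_scale := scottContinuous_of_limitSet_val fun k => by
    simp only [limitSet_val_convexCombPair, limitSet_val_bot]
    exact (ScottContinuous.fst.prodMk (ScottContinuous.snd.comp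
      (scottContinuous_limitSet_val k))).comp IsKegelspitze.scottContinuous_scale

theorem hasOrderedSequentialLimits : HasOrderedSequentialLimits KS.{u} := by
  intro D p
  refine ⟨⟨limitSet D p⟩, fun n => ⟨fun x => x.1 n, ⟨fun w => ?_⟩,
    scottContinuous_limitSet_val n, limitSet_val_bot n⟩, fun n => hom_ext fun x => x.2 n,
    fun B f hf => ⟨⟨fun b => ⟨fun n => (f n).toFun b, fun n => ?_⟩, ⟨fun w => ?_⟩,
      scottContinuous_of_limitSet_val fun n => (f n).scottContinuous, ?_⟩, fun n => rfl⟩,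
    fun B f g h b n => h n b⟩
  · have := limitSet_val_iConvexComb w id n
    rwa [iConvexComb_id] at this
  · exact congrArg (fun g : B ⟶ D n => g.toFun b) (hf n)
  · refine Subtype.ext (funext fun n => ?_)
    have := limitSet_val_iConvexComb (D := D) (p := p) w
      (fun b => ⟨fun n => (f n).toFun b, fun n =>
        congrArg (fun g : B ⟶ D n => g.toFun b) (hf n)⟩) n
    refine Eq.trans ?_ this.symm
    exact (f n).isAffine.map_sConvexComb w
  · exact Subtype.ext (funext fun n => (f n).strict.trans (limitSet_val_bot n).symm)

end SequentialLimit

end KS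

/-! ## Subconvex combinations -/

/-- The probability distribution on `n + 1` points that extends a subprobability distribution on
`n` points by the missing mass. -/
def subWeights {n : ℕ} (a : Fin n → ℝ≥0) (ha : ∑ j, a j ≤ 1) : StdSimplex ℝ (Fin (n + 1)) where
  weights := Finsupp.equivFunOnFinite.symm
    (Fin.cons (1 - ∑ j, (a j : ℝ)) fun j => (a j : ℝ) : Fin (n + 1) → ℝ)
  nonneg := by
    have h : ∑ j, (a j : ℝ) ≤ 1 := by exact_mod_cast ha
    intro i
    refine Fin.cases ?_ (fun j => ?_) i <;> simp [h]
  total := by simp [Finsupp.sum_fintype, Fin.sum_univ_succ]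

@[simp]
lemma subWeights_weights_zero {n : ℕ} (a : Fin n → ℝ≥0) (ha : ∑ j, a j ≤ 1) :
    (subWeights a ha).weights 0 = 1 - ∑ j, (a j : ℝ) := rfl

@[simp]
lemma subWeights_weights_succ {n : ℕ} (a : Fin n → ℝ≥0) (ha : ∑ j, a j ≤ 1) (j : Fin n) :
    (subWeights a ha).weights j.succ = a j := rfl

/-- Probability distributions on `Fin (n + 1)` agree if they agree away from `0`. -/
lemma Convexity.StdSimplex.ext_succ {n : ℕ} {r s : StdSimplex ℝ (Fin (n + 1))}
    (h : ∀ j : Fin n, r.weights j.succ = s.weights j.succ) : r = s := by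
  have hr := r.total
  have hs := s.total
  simp only [Finsupp.sum_fintype, Fin.sum_univ_succ, implies_true] at hr hs
  refine StdSimplex.ext (Finsupp.ext fun i => ?_)
  refine Fin.cases ?_ h i
  simp only [h] at hr
  linarith

lemma Convexity.StdSimplex.weights_iConvexComb_apply {I J : Type*} [Fintype I]
    (w : StdSimplex ℝ I) (f : I → StdSimplex ℝ J) (j : J) :
    (w.iConvexComb f).weights j = ∑ i, w.weights i * (f i).weights j := by
  have h : (w.iConvexComb f).weights = w.weights.sum fun i r => r • (f i).weights := by
    simp [iConvexComb, Finsupp.sum_mapDomain_index, add_smul]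
  rw [h, Finsupp.sum_fintype _ _ (by simp)]
  simp [Finsupp.finsetSum_apply]

section SubComb

variable {X : Type*} [CompletePartialOrder X] [ConvexSpace ℝ X]

/-- The subconvex combination `∑ aⱼ xⱼ`; the missing mass is put on `⊥`. -/
def subComb {n : ℕ} (a : Fin n → ℝ≥0) (ha : ∑ j, a j ≤ 1) (x : Fin n → X) : X :=
  (subWeights a ha).iConvexComb (Fin.cons ⊥ x : Fin (n + 1) → X)

lemma subComb_congr {n : ℕ} {a b : Fin n → ℝ≥0} (h : a = b) (ha : ∑ j, a j ≤ 1)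
    (hb : ∑ j, b j ≤ 1) (x : Fin n → X) : subComb a ha x = subComb b hb x := by
  subst h
  rfl

lemma subComb_bot {n : ℕ} (a : Fin n → ℝ≥0) (ha : ∑ j, a j ≤ 1) :
    subComb a ha (⊥ : Fin n → X) = ⊥ := by
  have : (Fin.cons ⊥ (⊥ : Fin n → X) : Fin (n + 1) → X) = fun _ => ⊥ :=
    funext fun i => Fin.cases rfl (fun _ => rfl) i
  rw [subComb, this, iConvexComb_const]

lemma subComb_zero {n : ℕ} (ha : ∑ j : Fin n, (0 : Fin n → ℝ≥0) j ≤ 1) (x : Fin n → X) :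
    subComb 0 ha x = ⊥ := by
  have : subWeights (0 : Fin n → ℝ≥0) ha = .single 0 :=
    StdSimplex.ext_succ fun j => by simp
  rw [subComb, this, iConvexComb_single, Fin.cons_zero]

lemma subComb_single {n : ℕ} (j : Fin n) (ha : ∑ l, (Pi.single j 1 : Fin n → ℝ≥0) l ≤ 1)
    (x : Fin n → X) : subComb (Pi.single j 1) ha x = x j := by
  have : subWeights (Pi.single j 1 : Fin n → ℝ≥0) ha = .single j.succ :=
    StdSimplex.ext_succ fun l => by
      simp [Finsupp.single_apply, Pi.single_apply, eq_comm, apply_ite]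
  rw [subComb, this, iConvexComb_single, Fin.cons_succ]

lemma sum_mul_le_one {n l : ℕ} {a : Fin n → ℝ≥0} (ha : ∑ j, a j ≤ 1)
    {B : Fin n → Fin l → ℝ≥0} (hB : ∀ i, ∑ j, B i j ≤ 1) :
    ∑ k, ∑ i, a i * B i k ≤ 1 := by
  rw [Finset.sum_comm]
  simp only [← Finset.mul_sum]
  refine (Finset.sum_le_sum fun i _ => mul_le_mul_right (hB i) (a i)).trans ?_
  simpa using ha

/-- This is associativity of convex combinations after adding the extra index `0`, at which the
inner distribution is the Dirac mass on `⊥`. The missing masses need no computation, as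
distributions are compared away from `0`. It yields functoriality for matrix products. -/
lemma subComb_subComb {n l : ℕ} (a : Fin n → ℝ≥0) (ha : ∑ j, a j ≤ 1)
    (B : Fin n → Fin l → ℝ≥0) (hB : ∀ i, ∑ j, B i j ≤ 1) (x : Fin l → X) :
    subComb a ha (fun i => subComb (B i) (hB i) x) =
      subComb (fun k => ∑ i, a i * B i k) (sum_mul_le_one ha hB) x := by
  let f : Fin (n + 1) → StdSimplex ℝ (Fin (l + 1)) :=
    Fin.cons (.single 0) fun i => subWeights (B i) (hB i)
  have h1 : (Fin.cons ⊥ (fun i => subComb (B i) (hB i) x) : Fin (n + 1) → X) =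
      fun i => (f i).iConvexComb (Fin.cons ⊥ x : Fin (l + 1) → X) := by
    funext i
    refine Fin.cases ?_ (fun i => ?_) i
    · simp [f]
    · rfl
  have h2 : (subWeights a ha).iConvexComb f =
      subWeights (fun k => ∑ i, a i * B i k) (sum_mul_le_one ha hB) :=
    StdSimplex.ext_succ fun k => by
      rw [StdSimplex.weights_iConvexComb_apply, Fin.sum_univ_succ]
      simp [f]
  rw [subComb, h1, iConvexComb_assoc, h2, subComb]

/-- The weights of a probability distribution, as non-negative reals. -/
def nnWeights {n : ℕ} (r : StdSimplex ℝ (Fin n)) (j : Fin n) : ℝ≥0 := ⟨r.weights j, r.nonneg j⟩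

@[simp]
lemma coe_nnWeights {n : ℕ} (r : StdSimplex ℝ (Fin n)) (j : Fin n) :
    (nnWeights r j : ℝ) = r.weights j := rfl

lemma sum_nnWeights {n : ℕ} (r : StdSimplex ℝ (Fin n)) : ∑ j, nnWeights r j = 1 := by
  have h := r.total
  rw [Finsupp.sum_fintype _ _ (by simp)] at h
  apply NNReal.coe_injective
  simpa using h

lemma subComb_nnWeights {n : ℕ} (r : StdSimplex ℝ (Fin n)) (x : Fin n → X) :
    subComb (nnWeights r) (sum_nnWeights r).le x = r.iConvexComb x := by
  have h : subWeights (nnWeights r) (sum_nnWeights r).le = r.map Fin.succ :=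
    StdSimplex.ext_succ fun j => by
      simp [Finsupp.mapDomain_apply (Fin.succ_injective n)]
  rw [subComb, h, iConvexComb_map]
  simp

lemma Convexity.IsAffineMap.map_subComb {Y : Type*} [CompletePartialOrder Y] [ConvexSpace ℝ Y]
    {f : X → Y} (hf : IsAffineMap ℝ f) (hbot : f ⊥ = ⊥) {n : ℕ} (a : Fin n → ℝ≥0)
    (ha : ∑ j, a j ≤ 1) (x : Fin n → X) :
    f (subComb a ha x) = subComb a ha fun j => f (x j) := by
  rw [subComb, hf.map_iConvexComb, subComb]
  congr 1
  funext i
  refine Fin.cases ?_ (fun i => ?_) i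
  · exact hbot
  · rfl

/-- Scalar multiplication by elements of the unit interval. -/
def scale (c : Set.Icc (0 : ℝ) 1) (x : X) : X :=
  convexCombPair (c : ℝ) (1 - (c : ℝ)) c.2.1 (sub_nonneg.2 c.2.2) (add_sub_cancel _ _) x ⊥

lemma scale_one (x : X) : scale (1 : Set.Icc (0 : ℝ) 1) x = x := by
  simp [scale]

/-- The inclusion of the unit interval into the non-negative reals. -/
def unitToNNReal (c : Set.Icc (0 : ℝ) 1) : ℝ≥0 := ⟨c, c.2.1⟩

@[simp]
lemma coe_unitToNNReal (c : Set.Icc (0 : ℝ) 1) : (unitToNNReal c : ℝ) = c := rfl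

lemma unitToNNReal_le {c d : Set.Icc (0 : ℝ) 1} :
    unitToNNReal c ≤ unitToNNReal d ↔ c ≤ d := Iff.rfl

lemma unitToNNReal_le_one (c : Set.Icc (0 : ℝ) 1) : unitToNNReal c ≤ 1 := c.2.2

lemma sum_single_le_one {n : ℕ} (j : Fin n) (c : Set.Icc (0 : ℝ) 1) :
    ∑ l, (Pi.single j (unitToNNReal c) : Fin n → ℝ≥0) l ≤ 1 := by
  simpa using unitToNNReal_le_one c

lemma subComb_single_eq_scale {n : ℕ} (j : Fin n) (c : Set.Icc (0 : ℝ) 1) (x : Fin n → X) :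
    subComb (Pi.single j (unitToNNReal c)) (sum_single_le_one j c) x = scale c (x j) := by
  have h : subWeights (Pi.single j (unitToNNReal c)) (sum_single_le_one j c) =
      .duple j.succ 0 c.2.1 (sub_nonneg.2 c.2.2) (add_sub_cancel _ _) :=
    StdSimplex.ext_succ fun l => by
      rcases eq_or_ne l j with rfl | hl
      · simp
      · simp [hl]
  rw [subComb, h, iConvexComb, StdSimplex.map_duple]
  rfl

variable [IsKegelspitze X]

lemma scottContinuous_subComb {n : ℕ} (a : Fin n → ℝ≥0) (ha : ∑ j, a j ≤ 1) :
    ScottContinuous fun x : Fin n → X => subComb a ha x := by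
  refine ScottContinuous.comp (f := fun x : Fin n → X => (Fin.cons ⊥ x : Fin (n + 1) → X))
    (scottContinuous_pi fun i => ?_) (IsKegelspitze.scottContinuous_convexComb (n + 1) _)
  refine Fin.cases ?_ (fun i => ?_) i
  · exact ScottContinuous.const _
  · exact scottContinuous_eval (β := fun _ => X) i

lemma scottContinuous_scale :
    ScottContinuous fun p : Set.Icc (0 : ℝ) 1 × X => scale p.1 p.2 :=
  IsKegelspitze.scottContinuous_scale

lemma scottContinuous_scale_left (x : X) :
    ScottContinuous fun c : Set.Icc (0 : ℝ) 1 => scale c x :=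
  (ScottContinuous.id.prodMk (ScottContinuous.const x)).comp scottContinuous_scale

/-- Subconvex combinations are Scott-continuous in the coefficients. -/
lemma isLUB_subComb {n : ℕ} {ι : Type*} [Nonempty ι] {a : ι → Fin n → ℝ≥0}
    (ha : ∀ i, ∑ j, a i j ≤ 1) (hdir : Directed (· ≤ ·) a) {b : Fin n → ℝ≥0}
    (hb : ∑ j, b j ≤ 1) (hab : IsLUB (Set.range a) b) (x : Fin n → X) :
    IsLUB (Set.range fun i => subComb (a i) (ha i) x) (subComb b hb x) := by
  have hle (i : ι) (j : Fin n) : a i j ≤ b j := hab.1 ⟨i, rfl⟩ j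
  have hlub (j : Fin n) : IsLUB (Set.range fun i => a i j) (b j) := by
    have := isLUB_pi.1 hab j
    rwa [← Set.range_comp] at this
  -- Factor `a i j = b j * c i j` with `c i j` in the unit interval, so that varying coefficients
  -- become varying scalars on the points. Where `b j = 0` the factor is arbitrary; the value `1`
  -- makes the supremum of `c` equal to `1` everywhere.
  let c (i : ι) (j : Fin n) : Set.Icc (0 : ℝ) 1 :=
    if b j = 0 then 1 else ⟨(a i j / b j : ℝ≥0), NNReal.coe_nonneg _,
      by exact_mod_cast div_le_one_of_le₀ (hle i j) zero_le⟩
  have hc (i : ι) (j : Fin n) : (b j * unitToNNReal (c i j)) = a i j := by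
    by_cases h : b j = 0
    · have : a i j = 0 := le_antisymm ((hle i j).trans_eq h) zero_le
      rw [h, this, zero_mul]
    · simp only [c, if_neg h]
      exact mul_div_cancel₀ _ h
  have hmono {i i' : ι} (h : a i ≤ a i') : c i ≤ c i' := by
    intro j
    by_cases hj : b j = 0
    · simp only [c, if_pos hj, le_refl]
    · simp only [c, if_neg hj]
      exact div_le_div_of_nonneg_right (h j) zero_le
  have hlubc : IsLUB (Set.range c) 1 := by
    refine isLUB_pi.2 fun j => ?_
    rw [← Set.range_comp]
    refine ⟨?_, fun t ht => ?_⟩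
    · rintro _ ⟨i, rfl⟩
      exact (c i j).2.2
    · by_cases hj : b j = 0
      · obtain ⟨i⟩ := ‹Nonempty ι›
        have := ht ⟨i, rfl⟩
        simpa [c, hj] using this
      · have h : b j ≤ b j * unitToNNReal t := by
          refine (hlub j).2 ?_
          rintro _ ⟨i, rfl⟩
          change a i j ≤ _
          rw [← hc i j]
          exact mul_le_mul_right (unitToNNReal_le.2 (ht ⟨i, rfl⟩)) (b j)
        have h2 : 1 ≤ unitToNNReal t :=
          le_of_mul_le_mul_left (by simpa using h) (pos_iff_ne_zero.2 hj)
        exact h2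
  -- With the coefficients frozen at `b`, only continuity of scalar multiplication and of one fixed
  -- combination is needed.
  have hG : ScottContinuous fun c : Fin n → Set.Icc (0 : ℝ) 1 =>
      subComb b hb fun j => scale (c j) (x j) :=
    ScottContinuous.comp (f := fun (c : Fin n → Set.Icc (0 : ℝ) 1) j => scale (c j) (x j))
      (scottContinuous_pi fun j => (scottContinuous_eval (β := fun _ => Set.Icc (0 : ℝ) 1) j).comp
        (scottContinuous_scale_left (x j))) (scottContinuous_subComb b hb)
  have h := hG (Set.range_nonempty c)
    (directedOn_range.2 fun i i' => (hdir i i').imp fun k hk => ⟨hmono hk.1, hmono hk.2⟩) hlubc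
  rw [← Set.range_comp] at h
  convert h using 1
  · congr 1
    funext i
    simp only [Function.comp_apply, ← subComb_single_eq_scale]
    rw [subComb_subComb]
    refine subComb_congr (funext fun k => ?_) _ _ _
    rw [Finset.sum_eq_single k (fun l _ hl => by simp [hl.symm]) (by simp),
      Pi.single_eq_same, hc]
  · simp [scale_one]

end SubComb

/-! ## The theory of subconvex sets -/

namespace SubconvexTheory

lemma hom_ext {n m : SubconvexTheory} {A B : n ⟶ m} (h : ∀ i, A.mat i = B.mat i) : A = B :=
  Hom.ext (funext h)

lemma le_def {n m : SubconvexTheory} {A B : n ⟶ m} : A ≤ B ↔ ∀ i, A.mat i ≤ B.mat i := Iff.rfl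

lemma id_mat (n : SubconvexTheory) (i : Fin n.arity) :
    Hom.mat (𝟙 n) i = Pi.single i 1 := by
  funext j
  exact (Matrix.one_apply).trans (by simp [Pi.single_apply, eq_comm])

lemma comp_mat {n m k : SubconvexTheory} (A : n ⟶ m) (B : m ⟶ k) (i : Fin k.arity) :
    (A ≫ B).mat i = fun j => ∑ l, B.mat i l * A.mat l j := rfl

/-- A morphism into the generic object, given by a single subprobability distribution. -/
def row {n : ℕ} (a : Fin n → ℝ≥0) (ha : ∑ j, a j ≤ 1) :
    (⟨n⟩ : SubconvexTheory) ⟶ (⟨1⟩ : SubconvexTheory) :=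
  ⟨fun _ => a, fun _ => ha⟩

lemma sum_single_one_le {n : ℕ} (j : Fin n) : ∑ l, (Pi.single j 1 : Fin n → ℝ≥0) l ≤ 1 := by
  simp

/-- The morphism that reindexes along a map of finite sets. -/
def reindex {n m : SubconvexTheory} (g : Fin m.arity → Fin n.arity) : n ⟶ m :=
  ⟨fun i => Pi.single (g i) 1, fun i => sum_single_one_le (g i)⟩

lemma comp_reindex_mat {n m k : SubconvexTheory} (A : n ⟶ m) (g : Fin k.arity → Fin m.arity)
    (i : Fin k.arity) : (A ≫ reindex g).mat i = A.mat (g i) := by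
  rw [comp_mat]
  funext j
  simp [reindex, Pi.single_apply]

lemma isLUB_mat_apply {n m : SubconvexTheory} {d : Set (n ⟶ m)} {b : n ⟶ m} (hb : IsLUB d b)
    (i : Fin m.arity) : IsLUB ((fun A : n ⟶ m => A.mat i) '' d) (b.mat i) := by
  refine ⟨?_, fun t ht => ?_⟩
  · rintro _ ⟨A, hA, rfl⟩
    exact hb.1 hA i
  -- Replace row `i` of `b` by its meet with `t`: since `t` may have total mass above `1`, the meet
  -- is what keeps the matrix subprobabilistic. The result still bounds `d`.
  · let r (k : Fin m.arity) : Fin n.arity → ℝ≥0 := if k = i then b.mat i ⊓ t else b.mat k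
    have hri : r i = b.mat i ⊓ t := if_pos rfl
    have hrk {k : Fin m.arity} (hk : k ≠ i) : r k = b.mat k := if_neg hk
    have hle (k : Fin m.arity) : r k ≤ b.mat k := by
      rcases eq_or_ne k i with rfl | hk
      · exact hri.trans_le inf_le_left
      · exact (hrk hk).le
    let b' : n ⟶ m :=
      ⟨r, fun k => (Finset.sum_le_sum fun j _ => hle k j).trans (b.sum_le_one k)⟩
    have h : b ≤ b' := hb.2 fun A hA k => by
      change A.mat k ≤ r k
      rcases eq_or_ne k i with rfl | hk
      · exact (le_inf (hb.1 hA k) (ht ⟨A, hA, rfl⟩)).trans_eq hri.symm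
      · exact (hb.1 hA k : A.mat k ≤ b.mat k).trans_eq (hrk hk).symm
    exact ((h i : b.mat i ≤ r i).trans_eq hri).trans inf_le_right

lemma mat_eq_zero_of_isBot {n m : SubconvexTheory} {b : n ⟶ m} (hb : IsBot b)
    (i : Fin m.arity) : b.mat i = 0 :=
  le_antisymm (hb ⟨0, fun _ => by simp⟩ i) fun _ => zero_le

lemma isBot_of_mat_eq_zero {n m : SubconvexTheory} {b : n ⟶ m} (hb : ∀ i, b.mat i = 0) :
    IsBot b := fun A i => by
  have h : b.mat i ≤ A.mat i := (hb i).trans_le fun _ => zero_le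
  exact h

/-- An object is the product of the objects given by a partition of its points. -/
def isLimitReindex {ι : Type} {m : ι → SubconvexTheory} {n : SubconvexTheory}
    (e : (Σ i, Fin (m i).arity) ≃ Fin n.arity) :
    IsLimit (Fan.mk n fun i => reindex fun r => e ⟨i, r⟩ : Fan m) :=
  Fan.IsLimit.mk _
    (fun s => ⟨fun c => (s.proj (e.symm c).1).mat (e.symm c).2, fun c =>
      (s.proj (e.symm c).1).sum_le_one (e.symm c).2⟩)
    (fun s i => hom_ext fun r => by
      refine (comp_reindex_mat _ _ _).trans ?_
      change (s.proj (e.symm (e ⟨i, r⟩)).1).mat (e.symm (e ⟨i, r⟩)).2 = _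
      rw [e.symm_apply_apply])
    (fun s f hf => hom_ext fun c => by
      change _ = (s.proj (e.symm c).1).mat (e.symm c).2
      rw [← hf]
      refine Eq.trans ?_ (comp_reindex_mat _ _ _).symm
      rw [Sigma.eta, e.apply_symm_apply])

end SubconvexTheory

/-! ## Powers of Kegelspitzen as models -/

namespace DcpoBot

/-- Powers of pointed dcpos. -/
def pow (X : DcpoBot.{u}) (n : ℕ) : DcpoBot.{u} := ⟨Fin n → X.carrier⟩

/-- The map between powers that reindexes along a map of finite sets. -/
def powReindex (X : DcpoBot.{u}) {n m : ℕ} (g : Fin m → Fin n) : X.pow n ⟶ X.pow m where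
  toFun x i := x (g i)
  scottContinuous := scottContinuous_pi fun i =>
    scottContinuous_eval (β := fun _ : Fin n => X.carrier) (g i)
  strict := rfl

/-- A power is the product of the powers given by a partition of the exponent. -/
def isLimitPowReindex (X : DcpoBot.{u}) {ι : Type} {m : ι → ℕ} {n : ℕ}
    (e : (Σ i, Fin (m i)) ≃ Fin n) :
    IsLimit (Fan.mk (X.pow n) fun i => X.powReindex fun r => e ⟨i, r⟩ : Fan fun i => X.pow (m i)) :=
  Fan.IsLimit.mk _
    (fun s => ⟨fun t c => (s.proj (e.symm c).1).toFun t (e.symm c).2,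
      scottContinuous_pi fun c => (s.proj (e.symm c).1).scottContinuous.comp
        (scottContinuous_eval (β := fun _ : Fin (m (e.symm c).1) => X.carrier) (e.symm c).2),
      funext fun c => congrFun (s.proj (e.symm c).1).strict (e.symm c).2⟩)
    (fun s i => hom_ext fun t => funext fun r => by
      change (s.proj (e.symm (e ⟨i, r⟩)).1).toFun t (e.symm (e ⟨i, r⟩)).2 = _
      rw [e.symm_apply_apply])
    (fun s f hf => hom_ext fun t => funext fun c => by
      change _ = (s.proj (e.symm c).1).toFun t (e.symm c).2
      rw [← hf]
      change f.toFun t c = f.toFun t (e ⟨_, _⟩)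
      rw [Sigma.eta, e.apply_symm_apply])

end DcpoBot

namespace KS

open SubconvexTheory

/-- The underlying pointed dcpo of a Kegelspitze. -/
def toDcpoBot (X : KS.{u}) : DcpoBot.{u} := ⟨X.carrier⟩

/-- The action of a matrix on the powers of a Kegelspitze. -/
def powMap (X : KS.{u}) {n m : SubconvexTheory} (A : n ⟶ m) :
    X.toDcpoBot.pow n.arity ⟶ X.toDcpoBot.pow m.arity where
  toFun x i := subComb (X := X.carrier) (A.mat i) (A.sum_le_one i) x
  scottContinuous := scottContinuous_pi fun i =>
    scottContinuous_subComb (X := X.carrier) (A.mat i) (A.sum_le_one i)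
  strict := funext fun i => subComb_bot (X := X.carrier) (A.mat i) (A.sum_le_one i)

lemma powMap_reindex (X : KS.{u}) {n m : SubconvexTheory} (g : Fin m.arity → Fin n.arity) :
    X.powMap (reindex g) = X.toDcpoBot.powReindex g :=
  DcpoBot.hom_ext fun x => funext fun i =>
    subComb_single (X := X.carrier) (g i) (sum_single_one_le (g i)) x

/-- The powers of a Kegelspitze, as a functor on the theory of subconvex sets. -/
def powFunctor (X : KS.{u}) : SubconvexTheory ⥤ DcpoBot.{u} where
  obj n := X.toDcpoBot.pow n.arity
  map A := X.powMap A
  map_id n := DcpoBot.hom_ext fun x => funext fun i =>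
    (subComb_congr (X := X.carrier) (id_mat n i) _ (sum_single_one_le i) x).trans
      (subComb_single (X := X.carrier) i _ x)
  map_comp A B := DcpoBot.hom_ext fun x => funext fun i =>
    (subComb_subComb (X := X.carrier) (B.mat i) (B.sum_le_one i) A.mat A.sum_le_one x).symm

/-- It suffices to treat one limit cone per diagram: the object of arity `∑ m i` with its block
projections, which goes to the power of `X` split into blocks. -/
lemma preservesFiniteProducts_powFunctor (X : KS.{u}) : PreservesFiniteProducts X.powFunctor where
  preserves k := ⟨fun {K} => by
    let m : Fin k → SubconvexTheory := fun i => K.obj ⟨i⟩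
    have iso : Discrete.functor m ≅ K := (Discrete.natIsoFunctor (F := K)).symm
    let e : (Σ i, Fin (m i).arity) ≃ Fin (∑ i, (m i).arity) := finSigmaFinEquiv
    have : PreservesLimit (Discrete.functor m) X.powFunctor := by
      refine preservesLimit_of_preserves_limit_cone
        (isLimitReindex (n := ⟨∑ i, (m i).arity⟩) e)
        ((isLimitMapConeFanMkEquiv X.powFunctor m _).symm ?_)
      have h : (fun i => X.powFunctor.map (reindex (n := ⟨∑ i, (m i).arity⟩) (m := m i)
          fun r => e ⟨i, r⟩)) = fun i => X.toDcpoBot.powReindex fun r => e ⟨i, r⟩ :=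
        funext fun i => X.powMap_reindex _
      rw [h]
      exact DcpoBot.isLimitPowReindex X.toDcpoBot e
    exact preservesLimit_of_iso_diagram X.powFunctor iso⟩

lemma isLocallyContinuous_powFunctor (X : KS.{u}) : IsLocallyContinuous X.powFunctor := by
  intro n m d hne hd b hb
  refine DcpoBot.isLUB_of_isLUB_apply fun x => ?_
  rw [Set.image_image]
  suffices h : IsLUB ((fun (A : n ⟶ m) (i : Fin m.arity) =>
      subComb (X := X.carrier) (A.mat i) (A.sum_le_one i) x) '' d)
      (fun i => subComb (X := X.carrier) (b.mat i) (b.sum_le_one i) x) from h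
  refine isLUB_pi.2 fun i => ?_
  rw [Set.image_image]
  have := hne.to_subtype
  have h := isLUB_mat_apply hb i
  rw [Set.image_eq_range] at h ⊢
  exact isLUB_subComb (X := X.carrier) (fun A : d => A.1.sum_le_one i)
    (fun A B => by
      obtain ⟨C, hC, hAC, hBC⟩ := hd A.1 A.2 B.1 B.2
      exact ⟨⟨C, hC⟩, hAC i, hBC i⟩) (b.sum_le_one i) h x

lemma isLocallyStrict_powFunctor (X : KS.{u}) : IsLocallyStrict X.powFunctor := by
  intro n m b hb f x i
  refine le_of_eq_of_le ?_ (bot_le (α := X.carrier))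
  exact (subComb_congr (X := X.carrier) (mat_eq_zero_of_isBot hb i) _ (by simp) x).trans
    (subComb_zero (X := X.carrier) (by simp) x)

/-- The action of a morphism of Kegelspitzen on powers. -/
def powNatTrans {X Y : KS.{u}} (f : X ⟶ Y) : X.powFunctor ⟶ Y.powFunctor where
  app n :=
    { toFun := fun (x : Fin n.arity → X.carrier) i => f.toFun (x i)
      scottContinuous := scottContinuous_pi fun i =>
        (scottContinuous_eval (β := fun _ : Fin n.arity => X.carrier) i).comp f.scottContinuous
      strict := funext fun _ => f.strict }
  naturality _ _ A := DcpoBot.hom_ext fun x => funext fun i =>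
    f.isAffine.map_subComb f.strict (A.mat i) (A.sum_le_one i) x

/-- The functor from Kegelspitzen to models. -/
def toModels : KS.{u} ⥤ Models.{u} where
  obj X := ⟨X.powFunctor, X.preservesFiniteProducts_powFunctor,
    X.isLocallyContinuous_powFunctor, X.isLocallyStrict_powFunctor⟩
  map f := ObjectProperty.homMk (powNatTrans f)

lemma le_iff_toModels_map_le {X Y : KS.{u}} (f g : X ⟶ Y) :
    f ≤ g ↔ toModels.map f ≤ toModels.map g :=
  ⟨fun h _ x i => h (x i), fun h x => h ⟨1⟩ (fun _ => x) (0 : Fin 1)⟩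

instance : toModels.{u}.Faithful where
  map_injective {_ _ f g} h :=
    le_antisymm ((le_iff_toModels_map_le f g).2 h.le) ((le_iff_toModels_map_le g f).2 h.ge)

/-- The components of a natural transformation between powers are determined by the one at the
generic object. -/
lemma natTrans_app_apply {X Y : KS.{u}} (η : X.powFunctor ⟶ Y.powFunctor) (n : SubconvexTheory)
    (x : Fin n.arity → X.carrier) (i : Fin n.arity) :
    ((η.app n).toFun x : Fin n.arity → Y.carrier) i =
      ((η.app ⟨1⟩).toFun (fun _ => x i : Fin 1 → X.carrier) : Fin 1 → Y.carrier) 0 := by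
  have h := congrArg (fun f => (f.toFun x : Fin 1 → Y.carrier) 0)
    (η.naturality (reindex (fun _ => i) : n ⟶ ⟨1⟩))
  have hX : X.powFunctor.map (reindex (fun _ => i) : n ⟶ ⟨1⟩) = X.toDcpoBot.powReindex _ :=
    X.powMap_reindex _
  have hY : Y.powFunctor.map (reindex (fun _ => i) : n ⟶ ⟨1⟩) = Y.toDcpoBot.powReindex _ :=
    Y.powMap_reindex _
  rw [hX, hY] at h
  exact h.symm

/-- The preimage is the component at the generic object; naturality at projections recovers all
other components from it. -/
instance : toModels.{u}.Full where
  map_surjective {X Y} η := by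
    let f (x : X.carrier) : Y.carrier :=
      ((η.hom.app ⟨1⟩).toFun (fun _ => x : Fin 1 → X.carrier) : Fin 1 → Y.carrier) 0
    have hη (n : SubconvexTheory) (x : Fin n.arity → X.carrier) (i : Fin n.arity) :
        ((η.hom.app n).toFun x : Fin n.arity → Y.carrier) i = f (x i) :=
      natTrans_app_apply η.hom n x i
    refine ⟨⟨f, ⟨fun w => ?_⟩, ?_, ?_⟩, ObjectProperty.hom_ext _ (NatTrans.ext (funext fun n =>
      DcpoBot.hom_ext fun x => funext fun i => (hη n x i).symm))⟩
    · obtain ⟨n, r, x, rfl⟩ := w.exists_eq_map_fin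
      -- Naturality at the single row `r` is affinity for the combination with weights `r`.
      let A := row (nnWeights r) (sum_nnWeights r).le
      have h := congrArg (fun f => (f.toFun x : Fin 1 → Y.carrier) 0) (η.hom.naturality A)
      change f (subComb (X := X.carrier) (nnWeights r) (sum_nnWeights r).le x) =
        subComb (X := Y.carrier) (nnWeights r) (sum_nnWeights r).le ((η.hom.app ⟨n⟩).toFun x) at h
      have hx : ((η.hom.app ⟨n⟩).toFun x : Fin n → Y.carrier) = fun i => f (x i) :=
        funext fun i => hη ⟨n⟩ x i
      rw [hx, subComb_nnWeights, subComb_nnWeights] at h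
      rw [StdSimplex.map_map]
      exact h
    · exact ScottContinuous.comp (f := fun (x : X.carrier) (_ : Fin 1) => x)
        (scottContinuous_pi fun _ => ScottContinuous.id) ((η.hom.app ⟨1⟩).scottContinuous.comp
          (scottContinuous_eval (β := fun _ : Fin 1 => Y.carrier) 0))
    · exact congrFun (η.hom.app ⟨1⟩).strict (0 : Fin 1)

end KS

/-! ## The Kegelspitze of a model -/

lemma Convexity.StdSimplex.map_weights_apply {n : ℕ} {M : Type*} [DecidableEq M]
    (r : StdSimplex ℝ (Fin n)) (x : Fin n → M) (p : M) :
    (r.map x).weights p = ∑ i, if x i = p then r.weights i else 0 := by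
  rw [StdSimplex.weights_map, Finsupp.mapDomain, Finsupp.sum_fintype _ _ (by simp),
    Finsupp.finsetSum_apply]
  exact Finset.sum_congr rfl fun i _ => by simp [Finsupp.single_apply]

/-- Finitely many finitely supported distributions are images of distributions on the same finite
set. -/
lemma Convexity.StdSimplex.exists_forall_eq_map_fin {M : Type*} {n : ℕ}
    (d : Fin n → StdSimplex ℝ M) :
    ∃ (l : ℕ) (B : Fin n → StdSimplex ℝ (Fin l)) (z : Fin l → M), ∀ i, d i = (B i).map z := by
  choose k r x h using fun i => (d i).exists_eq_map_fin
  refine ⟨∑ i, k i, fun i => (r i).map fun j => finSigmaFinEquiv ⟨i, j⟩,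
    fun c => x (finSigmaFinEquiv.symm c).1 (finSigmaFinEquiv.symm c).2, fun i => ?_⟩
  rw [StdSimplex.map_map, h i]
  congr 1
  funext j
  rw [Equiv.symm_apply_apply]

namespace DcpoBot

/-- The projections of a power. -/
def powEval (X : DcpoBot.{u}) {n : ℕ} (j : Fin n) : X.pow n ⟶ X where
  toFun x := x j
  scottContinuous := scottContinuous_eval (β := fun _ : Fin n => X.carrier) j
  strict := rfl

lemma toFun_eq_bot_of_isBot {X Y : DcpoBot.{u}} {b : X ⟶ Y} (hb : IsBot b) (x : X.carrier) :
    b.toFun x = ⊥ := by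
  have h := isLUB_apply (d := (∅ : Set (X ⟶ Y))) (by intro x hx; exact hx.elim)
    (isLUB_empty_iff.2 hb) x
  rw [Set.image_empty, isLUB_empty_iff] at h
  exact h.eq_bot

end DcpoBot

namespace SubconvexTheory

/-- The `j`-th projection of the `n`-th power of the generic object. -/
def proj {n : SubconvexTheory} (j : Fin n.arity) : n ⟶ ⟨1⟩ := reindex fun _ => j

/-- Every object is a power of the generic object. -/
def isLimitProj (n : SubconvexTheory) :
    IsLimit (Fan.mk n proj : Fan fun _ : Fin n.arity => (⟨1⟩ : SubconvexTheory)) :=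
  isLimitReindex (Equiv.sigmaUnique (Fin n.arity) fun _ => Fin 1)

lemma comp_proj {n m : SubconvexTheory} (A : n ⟶ m) (i : Fin m.arity) :
    A ≫ proj i = row (A.mat i) (A.sum_le_one i) :=
  hom_ext fun j => comp_reindex_mat A (fun _ : Fin 1 => i) j

variable (M : Models.{u})

/-- The value of a model at the generic object. -/
def generic : DcpoBot.{u} := M.obj.obj ⟨1⟩

/-- A model maps every object to a power of its value at the generic object. -/
def isLimitMapProj (n : SubconvexTheory) :
    IsLimit (Fan.mk (M.obj.obj n) fun j => M.obj.map (proj j) :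
      Fan fun _ : Fin n.arity => M.obj.obj ⟨1⟩) :=
  have := M.property.1
  isLimitFanMkObjOfIsLimit M.obj _ _ (isLimitProj n)

/-- The components of a point of a model. -/
def components (n : SubconvexTheory) : M.obj.obj n ⟶ (generic M).pow n.arity where
  toFun t j := (M.obj.map (proj j)).toFun t
  scottContinuous := scottContinuous_pi fun j => (M.obj.map (proj j)).scottContinuous
  strict := funext fun j => (M.obj.map (proj j)).strict

/-- The point of a model with given components. -/
def tuple (n : SubconvexTheory) : (generic M).pow n.arity ⟶ M.obj.obj n :=
  Fan.IsLimit.lift (isLimitMapProj M n) fun j => (generic M).powEval j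

lemma tuple_comp_map_proj (n : SubconvexTheory) (j : Fin n.arity) :
    tuple M n ≫ M.obj.map (proj j) = (generic M).powEval j :=
  Fan.IsLimit.fac (isLimitMapProj M n) (fun j => (generic M).powEval j) j

lemma tuple_comp_components (n : SubconvexTheory) : tuple M n ≫ components M n = 𝟙 _ :=
  DcpoBot.hom_ext fun x => funext fun j =>
    congrArg (fun f => f.toFun x) (tuple_comp_map_proj M n j)

lemma components_comp_tuple (n : SubconvexTheory) : components M n ≫ tuple M n = 𝟙 _ :=
  Fan.IsLimit.hom_ext (isLimitMapProj M n) _ _ fun j => by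
    change (components M n ≫ tuple M n) ≫ M.obj.map (proj j) = 𝟙 _ ≫ M.obj.map (proj j)
    rw [Category.assoc, tuple_comp_map_proj, Category.id_comp]
    rfl

lemma components_tuple {n : SubconvexTheory} (x : Fin n.arity → (generic M).carrier) :
    (components M n).toFun ((tuple M n).toFun x) = x :=
  congrArg (fun f => f.toFun x) (tuple_comp_components M n)

lemma tuple_components {n : SubconvexTheory} (t : (M.obj.obj n).carrier) :
    (tuple M n).toFun ((components M n).toFun t) = t :=
  congrArg (fun f => f.toFun t) (components_comp_tuple M n)

/-- Subconvex combinations in a model. -/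
def act {n : ℕ} (a : Fin n → ℝ≥0) (ha : ∑ j, a j ≤ 1) (x : Fin n → (generic M).carrier) :
    (generic M).carrier :=
  (M.obj.map (row a ha)).toFun ((tuple M ⟨n⟩).toFun x)

variable {M}

lemma act_congr {n : ℕ} {a b : Fin n → ℝ≥0} (h : a = b) (ha : ∑ j, a j ≤ 1)
    (hb : ∑ j, b j ≤ 1) (x : Fin n → (generic M).carrier) : act M a ha x = act M b hb x := by
  subst h
  rfl

/-- Composing `A` with the `i`-th projection leaves its `i`-th row, so `M` is determined by the
action of rows. -/
lemma map_tuple {n m : SubconvexTheory} (A : n ⟶ m) (x : Fin n.arity → (generic M).carrier) :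
    (M.obj.map A).toFun ((tuple M n).toFun x) =
      (tuple M m).toFun fun i => act M (A.mat i) (A.sum_le_one i) x := by
  rw [← tuple_components M ((M.obj.map A).toFun _)]
  congr 1
  funext i
  have h := M.obj.map_comp A (proj i)
  rw [comp_proj] at h
  exact (congrArg (fun f => f.toFun ((tuple M n).toFun x)) h).symm

lemma act_single {n : ℕ} (j : Fin n) (x : Fin n → (generic M).carrier) :
    act M (Pi.single j 1) (sum_single_one_le j) x = x j :=
  congrFun (components_tuple M (n := ⟨n⟩) x) j

lemma act_act {n l : ℕ} (a : Fin n → ℝ≥0) (ha : ∑ j, a j ≤ 1) (B : Fin n → Fin l → ℝ≥0)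
    (hB : ∀ i, ∑ j, B i j ≤ 1) (x : Fin l → (generic M).carrier) :
    act M a ha (fun i => act M (B i) (hB i) x) =
      act M (fun k => ∑ i, a i * B i k) (sum_mul_le_one ha hB) x := by
  let A : (⟨l⟩ : SubconvexTheory) ⟶ ⟨n⟩ := ⟨B, hB⟩
  have h := congrArg (fun f => f.toFun ((tuple M ⟨l⟩).toFun x)) (M.obj.map_comp A (row a ha))
  refine Eq.trans ?_ h.symm
  exact congrArg (M.obj.map (row a ha)).toFun (map_tuple A x).symm

lemma act_zero {n : ℕ} (ha : ∑ j : Fin n, (0 : Fin n → ℝ≥0) j ≤ 1)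
    (x : Fin n → (generic M).carrier) : act M 0 ha x = ⊥ :=
  DcpoBot.toFun_eq_bot_of_isBot
    (M.property.2.2 _ _ _ (isBot_of_mat_eq_zero fun _ => rfl)) _

lemma scottContinuous_act {n : ℕ} (a : Fin n → ℝ≥0) (ha : ∑ j, a j ≤ 1) :
    ScottContinuous fun x => act M a ha x :=
  (tuple M ⟨n⟩).scottContinuous.comp (M.obj.map (row a ha)).scottContinuous

/-- Subconvex combinations only depend on the total weight of each point. -/
lemma act_eq_act [DecidableEq (generic M).carrier] {n k : ℕ} {a : Fin n → ℝ≥0}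
    (ha : ∑ j, a j ≤ 1) {b : Fin k → ℝ≥0} (hb : ∑ j, b j ≤ 1) (x : Fin n → (generic M).carrier)
    (y : Fin k → (generic M).carrier)
    (h : ∀ p, (∑ i, if x i = p then a i else 0) = ∑ j, if y j = p then b j else 0) :
    act M a ha x = act M b hb y := by
  -- Both families factor through one injective enumeration `z` of their values. Substituting Dirac
  -- rows then collects the coefficients over each value.
  let S : Finset (generic M).carrier := Finset.univ.image x ∪ Finset.univ.image y
  let z (c : Fin S.card) : (generic M).carrier := S.equivFin.symm c
  have hz : Function.Injective z := Subtype.val_injective.comp S.equivFin.symm.injective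
  have key {m : ℕ} {c : Fin m → ℝ≥0} (hc : ∑ j, c j ≤ 1) (t : Fin m → (generic M).carrier)
      (ht : ∀ i, t i ∈ S) : ∃ hc', act M c hc t =
        act M (fun q => ∑ i, if t i = z q then c i else 0) hc' z := by
    let g (i : Fin m) : Fin S.card := S.equivFin ⟨t i, ht i⟩
    have hg (i : Fin m) : z (g i) = t i := by simp [z, g]
    have h1 : t = fun i => act M (Pi.single (g i) 1) (sum_single_one_le (g i)) z :=
      funext fun i => by rw [act_single, hg]
    have h2 : (fun q => ∑ i, c i * (Pi.single (g i) 1 : Fin S.card → ℝ≥0) q) =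
        fun q => ∑ i, if t i = z q then c i else 0 := by
      funext q
      refine Finset.sum_congr rfl fun i _ => ?_
      have : t i = z q ↔ q = g i := by rw [← hg, hz.eq_iff, eq_comm]
      simp [Pi.single_apply, this]
    have hc' := sum_mul_le_one hc fun i => sum_single_one_le (g i)
    refine ⟨by rwa [h2] at hc', ?_⟩
    conv_lhs => rw [h1]
    rw [act_act]
    exact act_congr h2 _ _ z
  obtain ⟨ha', h1⟩ := key ha x fun i => by simp [S]
  obtain ⟨hb', h2⟩ := key hb y fun i => by simp [S]
  rw [h1, h2]
  exact act_congr (funext fun q => h (z q)) _ _ z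

variable (M) in
/-- Convex combinations of finitely supported distributions on a model. -/
def modelConvexComb (w : StdSimplex ℝ (generic M).carrier) : (generic M).carrier :=
  act M (nnWeights w.exists_eq_map_fin.choose_spec.choose)
    (sum_nnWeights _).le w.exists_eq_map_fin.choose_spec.choose_spec.choose

/-- The chosen presentation of a distribution is immaterial: two presentations give every point the
same total weight. -/
lemma modelConvexComb_map {n : ℕ} (r : StdSimplex ℝ (Fin n))
    (x : Fin n → (generic M).carrier) :
    modelConvexComb M (r.map x) = act M (nnWeights r) (sum_nnWeights r).le x := by
  classical
  have h := (r.map x).exists_eq_map_fin.choose_spec.choose_spec.choose_spec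
  refine act_eq_act _ _ _ _ fun p => ?_
  apply NNReal.coe_injective
  have h' := congrArg (fun w => w.weights p) h
  simp only [StdSimplex.map_weights_apply] at h'
  push_cast [apply_ite]
  simp only [coe_nnWeights]
  exact h'.symm

variable (M) in
/-- The convex structure of a model. -/
@[reducible]
def convexSpace : ConvexSpace ℝ (generic M).carrier :=
  .mk (modelConvexComb M)
    (fun x => by
      have h1 : StdSimplex.single (R := ℝ) x =
          (StdSimplex.single (0 : Fin 1)).map fun _ => x := by simp
      rw [h1, modelConvexComb_map]
      refine (act_congr (funext fun j => ?_) _ (sum_single_one_le 0) _).trans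
        (act_single (0 : Fin 1) fun _ => x)
      apply NNReal.coe_injective
      simp [Subsingleton.elim j 0])
    (fun f => by
      obtain ⟨n, r, d, rfl⟩ := f.exists_eq_map_fin
      -- Placing all inner distributions on one finite index set makes associativity an instance of
      -- `act_act`.
      obtain ⟨l, B, z, hd⟩ := StdSimplex.exists_forall_eq_map_fin d
      obtain rfl : d = fun i => (B i).map z := funext hd
      have h1 : (r.map fun i => (B i).map z).sConvexComb = (r.iConvexComb B).map z :=
        (StdSimplex.isAffineMap_map ℝ z).map_iConvexComb r B |>.symm
      rw [h1, StdSimplex.map_map, modelConvexComb_map, modelConvexComb_map]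
      simp only [modelConvexComb_map]
      rw [act_act]
      refine act_congr (funext fun k => NNReal.coe_injective ?_) _ _ z
      simp [StdSimplex.weights_iConvexComb_apply])

-- Continuity of the convex structure of a model

attribute [local instance] convexSpace

lemma iConvexComb_eq_act {n : ℕ} (r : StdSimplex ℝ (Fin n)) (x : Fin n → (generic M).carrier) :
    r.iConvexComb x = act M (nnWeights r) (sum_nnWeights r).le x :=
  modelConvexComb_map r x

/-- By local strictness `⊥` is the action of the zero row, so the combination over `n + 1` points
collapses under `act_act` to the row `a`. -/
lemma subComb_eq_act {n : ℕ} (a : Fin n → ℝ≥0) (ha : ∑ j, a j ≤ 1)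
    (x : Fin n → (generic M).carrier) : subComb a ha x = act M a ha x := by
  let B : Fin (n + 1) → Fin n → ℝ≥0 := Fin.cons 0 fun i => Pi.single i 1
  have hB (i : Fin (n + 1)) : ∑ j, B i j ≤ 1 := by
    refine Fin.cases ?_ (fun i => ?_) i
    · simp [B]
    · exact sum_single_one_le i
  have h : (Fin.cons ⊥ x : Fin (n + 1) → (generic M).carrier) = fun i => act M (B i) (hB i) x := by
    funext i
    refine Fin.cases ?_ (fun i => ?_) i
    · exact (act_zero (by simp) x).symm
    · exact (act_single i x).symm
  rw [subComb, iConvexComb_eq_act, h, act_act]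
  refine act_congr (funext fun k => ?_) _ _ x
  apply NNReal.coe_injective
  simp [Fin.sum_univ_succ, B, Pi.single_apply, apply_ite]

/-- Endomorphisms of the generic object are scalars in the unit interval with the same order. This
puts suprema of scalars in the form to which local continuity applies. -/
lemma isLUB_row_single {d : Set (Set.Icc (0 : ℝ) 1)} {c : Set.Icc (0 : ℝ) 1} (hc : IsLUB d c) :
    IsLUB ((fun c => row (Pi.single (0 : Fin 1) (unitToNNReal c)) (sum_single_le_one 0 c)) '' d)
      (row (Pi.single (0 : Fin 1) (unitToNNReal c)) (sum_single_le_one 0 c)) := by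
  have le_iff {c : Set.Icc (0 : ℝ) 1} {T : (⟨1⟩ : SubconvexTheory) ⟶ ⟨1⟩} :
      row (Pi.single (0 : Fin 1) (unitToNNReal c)) (sum_single_le_one 0 c) ≤ T ↔
        unitToNNReal c ≤ T.mat (0 : Fin 1) (0 : Fin 1) := by
    refine ⟨fun h => ?_, fun h i j => ?_⟩
    · have := h (0 : Fin 1) (0 : Fin 1)
      simpa [row] using this
    · obtain rfl : i = (0 : Fin 1) := Subsingleton.elim _ _
      obtain rfl : j = (0 : Fin 1) := Subsingleton.elim _ _
      simpa [row] using h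
  refine ⟨?_, fun T hT => ?_⟩
  · rintro _ ⟨c', hc', rfl⟩
    refine le_iff.2 ?_
    simpa [row, unitToNNReal_le] using hc.1 hc'
  · have h1 : T.mat (0 : Fin 1) (0 : Fin 1) ≤ 1 := by
      have := T.sum_le_one (0 : Fin 1)
      exact (Finset.single_le_sum (f := fun j => T.mat (0 : Fin 1) j) (fun _ _ => zero_le)
        (Finset.mem_univ (0 : Fin 1))).trans this
    refine le_iff.2 ?_
    have h2 : c ≤ ⟨T.mat (0 : Fin 1) (0 : Fin 1), NNReal.coe_nonneg _, by exact_mod_cast h1⟩ :=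
      hc.2 fun c' hc' => le_iff.1 (hT ⟨c', hc', rfl⟩)
    exact h2

instance isKegelspitze_generic : IsKegelspitze (generic M).carrier where
  scottContinuous_convexComb n r := by
    simp only [iConvexComb_eq_act]
    exact scottContinuous_act _ _
  scottContinuous_scale := by
    have h (p : Set.Icc (0 : ℝ) 1 × (generic M).carrier) :
        convexCombPair (p.1 : ℝ) (1 - (p.1 : ℝ)) p.1.2.1 (sub_nonneg.2 p.1.2.2)
          (add_sub_cancel _ _) p.2 ⊥ =
        act M (Pi.single (0 : Fin 1) (unitToNNReal p.1)) (sum_single_le_one 0 p.1)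
          fun _ => p.2 := by
      rw [← subComb_eq_act, subComb_single_eq_scale]
      rfl
    simp only [h]
    -- Separate continuity suffices: in the point it comes from `scottContinuous_act`, in the scalar
    -- from local continuity of `M`.
    refine ScottContinuous.fromProd (fun c => ?_) fun x => ?_
    · exact ScottContinuous.comp (f := fun (x : (generic M).carrier) (_ : Fin 1) => x)
        (scottContinuous_pi fun _ => ScottContinuous.id)
        (scottContinuous_act (Pi.single (0 : Fin 1) (unitToNNReal c)) (sum_single_le_one 0 c))
    · intro d hne hd c hc
      have hdir : DirectedOn (· ≤ ·) ((fun c => row (Pi.single (0 : Fin 1) (unitToNNReal c))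
          (sum_single_le_one 0 c)) '' d) :=
        directedOn_image.2 (hd.mono fun _ _ h _ => Pi.single_mono 0 (unitToNNReal_le.2 h))
      have h1 := M.property.2.1 ⟨1⟩ ⟨1⟩ (hne.image _) hdir (isLUB_row_single hc)
      have h2 := DcpoBot.isLUB_apply (directedOn_image.2 (hdir.mono fun _ _ h =>
        (M.property.2.1 ⟨1⟩ ⟨1⟩).monotone h)) h1 ((tuple M ⟨1⟩).toFun fun _ => x)
      rw [Set.image_image, Set.image_image] at h2
      exact h2

/-! ### Essential surjectivity and order-reflection of the inverse -/

variable (M) in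
/-- The Kegelspitze of a model. -/
def toKS : KS.{u} where
  carrier := (generic M).carrier
  order := (generic M).order
  convex := convexSpace M
  isKegelspitze := isKegelspitze_generic

variable (M) in
/-- Every model is isomorphic to the model of powers of its Kegelspitze. -/
def toModelsToKSIso : KS.toModels.obj (toKS M) ≅ M :=
  ObjectProperty.isoMk _ (NatIso.ofComponents
    (fun n => (⟨tuple M n, components M n, tuple_comp_components M n,
      components_comp_tuple M n⟩ : (generic M).pow n.arity ≅ M.obj.obj n))
    fun {n m} A => DcpoBot.hom_ext fun x => by
      refine Eq.trans ?_ (map_tuple A x).symm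
      exact congrArg (tuple M m).toFun
        (funext fun i => subComb_eq_act (A.mat i) (A.sum_le_one i) x))

instance : KS.toModels.{u}.EssSurj where
  mem_essImage M := ⟨toKS M, ⟨toModelsToKSIso M⟩⟩

instance : KS.toModels.{u}.IsEquivalence where

lemma comp_le_comp {M₁ M₂ M₃ M₄ : Models.{u}} (a : M₁ ⟶ M₂) {f g : M₂ ⟶ M₃} (h : f ≤ g)
    (b : M₃ ⟶ M₄) : a ≫ f ≫ b ≤ a ≫ g ≫ b :=
  fun n x => (b.hom.app n).scottContinuous.monotone (h n ((a.hom.app n).toFun x))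

/-- An equivalence that preserves and reflects the order has an inverse with this property. -/
lemma le_iff_inverse_map_le (e : KS.{u} ≌ Models.{u})
    (he : ∀ (X Y : KS.{u}) (f g : X ⟶ Y), f ≤ g ↔ e.functor.map f ≤ e.functor.map g)
    {M N : Models.{u}} (f g : M ⟶ N) : f ≤ g ↔ e.inverse.map f ≤ e.inverse.map g := by
  -- Each `h` is recovered from its image by conjugation with the counit, which is monotone.
  have h2 (h : M ⟶ N) :
      h = e.counitInv.app M ≫ e.functor.map (e.inverse.map h) ≫ e.counit.app N := by
    rw [e.fun_inv_map]
    simp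
  rw [he]
  constructor
  · intro h
    rw [e.fun_inv_map, e.fun_inv_map]
    exact comp_le_comp _ h _
  · intro h
    rw [h2 f, h2 g]
    exact comp_le_comp _ h _

end SubconvexTheory

end

theorem mainTheorem6 :
    (IsDcpoBotEnriched KS.{u} ∧ IsDcpoBotEnriched SubconvexTheory.Models.{u}) ∧
    (∃ Φ : KS.{u} ≌ SubconvexTheory.Models.{u},
      ∀ (X Y : KS.{u}) (f g : X ⟶ Y), f ≤ g ↔ Φ.functor.map f ≤ Φ.functor.map g) ∧
    IsAlgebraicallyCompactFor KS.{u} (fun F => IsLocallyContinuous F) ∧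
    IsAlgebraicallyCompactFor SubconvexTheory.Models.{u} (fun F => IsLocallyContinuous F) := by
  let Φ := KS.toModels.{u}.asEquivalence
  have hΦ (X Y : KS.{u}) (f g : X ⟶ Y) : f ≤ g ↔ Φ.functor.map f ≤ Φ.functor.map g :=
    KS.le_iff_toModels_map_le f g
  have hG (M N : SubconvexTheory.Models.{u}) (f g : M ⟶ N) :=
    SubconvexTheory.le_iff_inverse_map_le Φ hΦ f g
  have hM := KS.isDcpoBotEnriched.of_fullyFaithful Φ.inverse hG
  exact ⟨⟨KS.isDcpoBotEnriched, hM⟩,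
    ⟨Φ, hΦ⟩,
    isAlgebraicallyCompactFor_isLocallyContinuous KS.isDcpoBotEnriched KS.exists_isBot_id
      KS.hasOrderedSequentialLimits,
    isAlgebraicallyCompactFor_isLocallyContinuous hM
      (exists_isBot_id_of_essSurj Φ.inverse KS.isDcpoBotEnriched hG KS.exists_isBot_id)
      (KS.hasOrderedSequentialLimits.of_essSurj Φ.inverse KS.isDcpoBotEnriched hG)⟩
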